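/- Definitions. All graphs are finite and simple. An \emph{AT-graph} is a pair $(G,\mathcal X)$ where $G$ is a graph and $\mathcal X$ is a set of unordered pairs of independent (that is, nonadjacent) edges of $G$; it is \emph{complete} if $G$ is a complete graph. An \emph{AT-subgraph} of $(G,\mathcal X)$ is an AT-graph $(H,\mathcal Y)$ where $H$ is a subgraph of $G$ and $\mathcal Y=\mathcal X\cap\binom{E(H)}{2}$. An AT-graph $(G,\mathcal X)$ is called an \emph{even} (\emph{odd}) $G$ if $|\mathcal X|$ is even (odd). A \emph{drawing} of $G$ represents the vertices by distinct points of the plane and the edges by simple curves connecting the corresponding points, so that (1) the edges pass through no vertices except their endpoints, (2) every two edges have finitely many common points, (3) every common point of two edges is a common endpoint or a proper crossing, and (4) no three edges pass through the same crossing. The AT-graph $(G,\mathcal X)$ is \emph{independently $\mathbb Z_2$-realizable} if $G$ has a drawing in which $\mathcal X$ is exactly the set of pairs of independent edges that cross an odd number of times. For a complete graph $K_n$, let $M$ be the number of unordered pairs of independent edges, and identify each $\mathbf x\in\mathbb Z_2^M$ with the AT-graph on $K_n$ whose set of pairs has characteristic vector $\mathbf x$. For an edge $e$ and a vertex $v\notin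 e$, let $\mathbf w_{(e,v)}\in\mathbb Z_2^M$ be the vector whose components equal to $1$ are exactly those indexed by the pairs $\{e,f\}$ of independent edges with $f$ incident to $v$. Theorem. (a) A complete AT-graph is independently $\mathbb Z_2$-realizable if and only if it contains no even $K_5$ and no odd $2K_3$ (disjoint union of two triangles) as an AT-subgraph. (b) Every complete AT-graph that is not independently $\mathbb Z_2$-realizable has an AT-subgraph on at most six vertices that is not independently $\mathbb Z_2$-realizable. (c) For every $n$, the linear span of the vectors $\mathbf w_{(e,v)}$ in $\mathbb Z_2^M$ is equal to the set of all vectors $\mathbf x\in\mathbb Z_2^M$ whose AT-graph on $K_n$ contains no odd $K_5$ and no odd $2K_3$ as an AT-subgraph. -/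

import Mathlib

open scoped SimpleGraph

/-- Two edges are independent (nonadjacent) if they have no common endpoint. -/
def IndependentEdges {V : Type*} (e f : Sym2 V) : Prop :=
  ∀ v : V, ¬ (v ∈ e ∧ v ∈ f)

/-- The set of unordered pairs of independent edges of `G`. -/
def indepPairs {V : Type*} (G : SimpleGraph V) : Set (Sym2 (Sym2 V)) :=
  {p | ∃ e f : Sym2 V, e ∈ G.edgeSet ∧ f ∈ G.edgeSet ∧ IndependentEdges e f ∧ p = s(e, f)}

/-- An abstract topological graph `(G, 𝒳)`: a graph together with a set of pairs of
independent edges. -/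
structure ATGraph (V : Type*) where
  graph : SimpleGraph V
  pairs : Set (Sym2 (Sym2 V))
  pairs_subset : pairs ⊆ indepPairs graph

/-- `p` is a proper crossing of the curves `a` and `b`: in some local coordinates of the plane
around `p`, the curve `a` is the horizontal axis and `b` is the vertical axis. The plane is
modelled by `ℂ`, of which only the topology is used. -/
def IsProperCrossing (a b : Set ℂ) (p : ℂ) : Prop :=
  ∃ φ : OpenPartialHomeomorph ℂ ℂ, p ∈ φ.source ∧ φ p = 0 ∧
    ∀ z ∈ φ.source, (z ∈ a ↔ (φ z).im = 0) ∧ (z ∈ b ↔ (φ z).re = 0)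

/-- A topological graph: a drawing of `G` in the plane in general position. -/
structure Drawing {V : Type*} (G : SimpleGraph V) where
  /-- the points representing the vertices -/
  vert : V → ℂ
  vert_injective : Function.Injective vert
  /-- the curves representing the edges -/
  edge : G.edgeSet → Set ℂ
  /-- every edge is a simple curve connecting the points that represent its endpoints -/
  edge_arc : ∀ e : G.edgeSet, ∃ γ : C(unitInterval, ℂ), Function.Injective γ ∧
    Set.range γ = edge e ∧ s(γ 0, γ 1) = (e : Sym2 V).map vert
  /-- edges pass through no vertices except their endpoints -/
  vert_mem_edge : ∀ (v : V) (e : G.edgeSet), vert v ∈ edge e → v ∈ (e : Sym2 V)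
  /-- two edges have finitely many common points -/
  inter_finite : ∀ e f : G.edgeSet, e ≠ f → (edge e ∩ edge f).Finite
  /-- every common point of two edges is a common endpoint or a proper crossing -/
  inter_proper : ∀ e f : G.edgeSet, e ≠ f → ∀ p ∈ edge e ∩ edge f,
    (∃ v : V, v ∈ (e : Sym2 V) ∧ v ∈ (f : Sym2 V) ∧ vert v = p) ∨
      IsProperCrossing (edge e) (edge f) p
  /-- no three edges pass through the same crossing -/
  no_triple : ∀ e f g : G.edgeSet, e ≠ f → e ≠ g → f ≠ g →
    ∀ p, p ∈ edge e → p ∈ edge f → p ∈ edge g → p ∈ Set.range vert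

/-- The crossings of two edges: their common points other than common endpoints. -/
def Drawing.crossings {V : Type*} {G : SimpleGraph V} (D : Drawing G) (e f : G.edgeSet) :
    Set ℂ :=
  (D.edge e ∩ D.edge f) \ Set.range D.vert

namespace ATGraph

/-- `A` is complete if its underlying graph is. -/
def IsComplete {V : Type*} (A : ATGraph V) : Prop := A.graph = ⊤

/-- `D` is an independent `ℤ₂`-realization of `A`: the pairs of `A` are exactly the pairs of
independent edges that cross an odd number of times in `D`. -/
def IsIndepZ2Realization {V : Type*} (A : ATGraph V) (D : Drawing A.graph) : Prop :=
  ∀ e f : A.graph.edgeSet, IndependentEdges (e : Sym2 V) (f : Sym2 V) →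
    (s((e : Sym2 V), (f : Sym2 V)) ∈ A.pairs ↔ Odd (D.crossings e f).ncard)

/-- `A` is independently `ℤ₂`-realizable. -/
def IndepZ2Realizable {V : Type*} (A : ATGraph V) : Prop :=
  ∃ D : Drawing A.graph, A.IsIndepZ2Realization D

/-- The AT-subgraph of `A` whose underlying graph is the subgraph `H`; its pairs are all the
pairs of `A` formed by edges of `H`. -/
def sub {V : Type*} (A : ATGraph V) (H : A.graph.Subgraph) : ATGraph H.verts where
  graph := H.coe
  pairs := {p | p ∈ indepPairs H.coe ∧ p.map (Sym2.map Subtype.val) ∈ A.pairs}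
  pairs_subset := fun _ hp => hp.1

/-- `A` has an even `K` as an AT-subgraph. -/
def ContainsEven {V W : Type*} (A : ATGraph V) (K : SimpleGraph W) : Prop :=
  ∃ H : A.graph.Subgraph, Nonempty (H.coe ≃g K) ∧ Even (A.sub H).pairs.ncard

/-- `A` has an odd `K` as an AT-subgraph. -/
def ContainsOdd {V W : Type*} (A : ATGraph V) (K : SimpleGraph W) : Prop :=
  ∃ H : A.graph.Subgraph, Nonempty (H.coe ≃g K) ∧ Odd (A.sub H).pairs.ncard

/-- The AT-graph on `G` with characteristic vector `x`. -/
def ofVector {V : Type*} {G : SimpleGraph V} (x : indepPairs G → ZMod 2) : ATGraph V where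
  graph := G
  pairs := {p | ∃ h : p ∈ indepPairs G, x ⟨p, h⟩ = 1}
  pairs_subset := fun _ hp => hp.1

end ATGraph

/-- The complete graph on five vertices. -/
abbrev graphK5 : SimpleGraph (Fin 5) := ⊤

/-- The disjoint union of two triangles. -/
abbrev graph2K3 : SimpleGraph (Fin 3 ⊕ Fin 3) :=
  (⊤ : SimpleGraph (Fin 3)) ⊕g (⊤ : SimpleGraph (Fin 3))

open Classical in
/-- The vector of the edge-vertex switch `(e, v)`: its components equal to `1` are those indexed
by the pairs `{e, f}` with `f` incident to `v`. -/
noncomputable def switchVector {V : Type*} (G : SimpleGraph V) (e : Sym2 V) (v : V) :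
    indepPairs G → ZMod 2 :=
  fun p => if ∃ f : Sym2 V, v ∈ f ∧ (p : Sym2 (Sym2 V)) = s(e, f) then 1 else 0

/-- The space spanned by the vectors of all edge-vertex switches `(e, v)` with `v ∉ e`. -/
noncomputable def switchSpace {V : Type*} (G : SimpleGraph V) :
    Submodule (ZMod 2) (indepPairs G → ZMod 2) :=
  Submodule.span (ZMod 2)
    {w | ∃ e ∈ G.edgeSet, ∃ v : V, v ∉ e ∧ w = switchVector G e v}

/-- The vectors with the `K₅`-property (no odd `K₅`) and the `2K₃`-property (no odd `2K₃`). -/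
def propertyVectors {V : Type*} (G : SimpleGraph V) : Set (indepPairs G → ZMod 2) :=
  {x | ¬ (ATGraph.ofVector x).ContainsOdd graphK5 ∧
    ¬ (ATGraph.ofVector x).ContainsOdd graph2K3}

/-!
Let `e` and `f` be independent edges of a drawing, parametrized by `α` and `β`. The number of their
crossings is, modulo two, the index of `α s - β t` around the parameter square, that is, the change
of its logarithm divided by `2πi`. On each side of the square one of the curves rests at a vertex,
so this index only involves the numbers of turns of an edge around a vertex. Measured against
principal logarithms, these numbers are the coefficients of a combination of edge-vertex switches;
the remaining term is the same for all drawings with these vertices and is the vector of the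
rectilinear drawing of points on a convex curve. As switches change neither the parity of a `K₅`
nor that of a `2K₃`, the necessity of the two conditions follows.

Conversely, linear algebra shows that a vector with no odd `K₅` and no odd `2K₃` is a combination
of switches, so it remains to draw every combination. Put the vertices on the real line and let each
edge pass every other vertex on a prescribed side, along a curve given by polynomials. Each edge
varies in a one-parameter pencil of such curves, and almost every choice of the parameters gives a
drawing in general position with the prescribed numbers of turns.
-/

/-! ### Change of the logarithm along a curve -/

section LogChange

open Complex Set Topology
open scoped Real

theorem exists_continuousOn_uIcc_exp_eq {E : Type*} [Lattice E] [AddCommGroup E] [Module ℝ E]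
    [TopologicalSpace E] [ContinuousAdd E] [ContinuousSMul ℝ E] [LocallyPathConnectedSpace E]
    [TopologicalLattice E] {F : E → ℂ} {a b : E} (hF : ContinuousOn F (uIcc a b))
    (h0 : ∀ x ∈ uIcc a b, F x ≠ 0) :
    ∃ L : E → ℂ, ContinuousOn L (uIcc a b) ∧ ∀ x ∈ uIcc a b, exp (L x) = F x := by
  let clamp : E → E := fun x => (a ⊓ b) ⊔ (x ⊓ (a ⊔ b))
  have hmem : ∀ x, clamp x ∈ uIcc a b := fun x => ⟨le_sup_left, sup_le inf_le_sup inf_le_right⟩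
  have hid : ∀ x ∈ uIcc a b, clamp x = x := fun x hx => by
    simp only [clamp, inf_eq_left.2 hx.2, sup_eq_right.2 hx.1]
  have hclamp : Continuous clamp := continuous_const.sup (continuous_id.inf continuous_const)
  obtain ⟨L, ⟨-, hL⟩, -⟩ := isCoveringMapOn_exp.existsUnique_continuousMap_lifts
    (⟨F ∘ clamp, hF.comp_continuous hclamp hmem⟩ : C(E, ℂ)) (a₀ := 0)
    (exp_log (h0 _ (hmem 0))) (fun x => h0 _ (hmem x))
  exact ⟨L, L.continuous.continuousOn, fun x hx => by
    simpa only [Function.comp_apply, ContinuousMap.coe_mk, hid x hx] using congrFun hL x⟩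

/-- `F` is continuous and has no zero between `a` and `b`. -/
structure NonvanishingOn (F : ℝ → ℂ) (a b : ℝ) : Prop where
  continuousOn : ContinuousOn F (uIcc a b)
  ne_zero : ∀ x ∈ uIcc a b, F x ≠ 0

/-- `L` is a continuous logarithm of `F` between `a` and `b`. -/
structure IsLogLift (F : ℝ → ℂ) (a b : ℝ) (L : ℝ → ℂ) : Prop where
  continuousOn : ContinuousOn L (uIcc a b)
  exp_eq : ∀ x ∈ uIcc a b, exp (L x) = F x

open Classical in
/-- The change of a continuous logarithm of `F` from `a` to `b`; it is `0` if there is no such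
logarithm. -/
noncomputable def logChange (F : ℝ → ℂ) (a b : ℝ) : ℂ :=
  if h : ∃ L, IsLogLift F a b L then h.choose b - h.choose a else 0

variable {F : ℝ → ℂ} {a b c d : ℝ} {L L' : ℝ → ℂ}

theorem IsLogLift.sub_eq_sub (h : IsLogLift F a b L) (h' : IsLogLift F a b L') :
    L b - L a = L' b - L' a := by
  let shifted : ℝ → ℂ := fun x => L' x + (L a - L' a)
  have hexp : exp (L a - L' a) = 1 := by
    rw [exp_sub, h.exp_eq a left_mem_uIcc, ← h'.exp_eq a left_mem_uIcc, div_self (exp_ne_zero _)]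
  have hagree : EqOn L shifted (uIcc a b) := by
    refine isCoveringMap_exp.eqOn_of_comp_eqOn isPreconnected_uIcc h.continuousOn
      (h'.continuousOn.add continuousOn_const) (fun x hx => Subtype.ext ?_) left_mem_uIcc
      (by simp only [shifted, add_sub_cancel])
    simp only [Function.comp_apply, shifted, exp_add, hexp, mul_one, h.exp_eq x hx, h'.exp_eq x hx]
  rw [hagree right_mem_uIcc]
  ring

theorem IsLogLift.logChange_eq (h : IsLogLift F a b L) : logChange F a b = L b - L a := by
  have hex : ∃ L, IsLogLift F a b L := ⟨L, h⟩
  rw [logChange, dif_pos hex]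
  exact hex.choose_spec.sub_eq_sub h

theorem IsLogLift.mono (h : IsLogLift F a b L) (hs : uIcc c d ⊆ uIcc a b) : IsLogLift F c d L :=
  ⟨h.continuousOn.mono hs, fun x hx => h.exp_eq x (hs hx)⟩

theorem NonvanishingOn.exists_isLogLift (h : NonvanishingOn F a b) : ∃ L, IsLogLift F a b L :=
  let ⟨L, hL, hexp⟩ := exists_continuousOn_uIcc_exp_eq h.continuousOn h.ne_zero
  ⟨L, hL, hexp⟩

theorem NonvanishingOn.comp (h : NonvanishingOn F c d) {α : ℝ → ℝ}
    (hα : ContinuousOn α (uIcc a b)) (hm : MapsTo α (uIcc a b) (uIcc c d)) :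
    NonvanishingOn (fun s => F (α s)) a b :=
  ⟨h.continuousOn.comp hα hm, fun _ hx => h.ne_zero _ (hm hx)⟩

theorem logChange_congr {F G : ℝ → ℂ} (h : EqOn F G (uIcc a b)) :
    logChange F a b = logChange G a b := by
  have : IsLogLift F a b = IsLogLift G a b := funext fun L => propext
    ⟨fun hL => ⟨hL.1, fun x hx => (hL.2 x hx).trans (h hx)⟩,
      fun hL => ⟨hL.1, fun x hx => (hL.2 x hx).trans (h hx).symm⟩⟩
  unfold logChange
  rw [this]

theorem logChange_symm (F : ℝ → ℂ) (a b : ℝ) : logChange F b a = -logChange F a b := by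
  have hcomm : ∀ L, IsLogLift F b a L ↔ IsLogLift F a b L := fun L =>
    ⟨fun h => h.mono (uIcc_comm a b).subset, fun h => h.mono (uIcc_comm b a).subset⟩
  by_cases h : ∃ L, IsLogLift F a b L
  · obtain ⟨L, hL⟩ := h
    rw [hL.logChange_eq, ((hcomm L).2 hL).logChange_eq, neg_sub]
  · have h' : ¬ ∃ L, IsLogLift F b a L := by simpa only [hcomm] using h
    rw [logChange, logChange, dif_neg h, dif_neg h', neg_zero]

theorem logChange_add_logChange (h : NonvanishingOn F a c) (hb : b ∈ uIcc a c) :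
    logChange F a b + logChange F b c = logChange F a c := by
  obtain ⟨L, hL⟩ := h.exists_isLogLift
  rw [hL.logChange_eq, (hL.mono (uIcc_subset_uIcc_left hb)).logChange_eq,
    (hL.mono (uIcc_subset_uIcc_right hb)).logChange_eq]
  ring

theorem exp_logChange (h : NonvanishingOn F a b) : exp (logChange F a b) = F b / F a := by
  obtain ⟨L, hL⟩ := h.exists_isLogLift
  rw [hL.logChange_eq, exp_sub, hL.exp_eq _ left_mem_uIcc, hL.exp_eq _ right_mem_uIcc]

theorem logChange_comp {α : ℝ → ℝ} (h : NonvanishingOn F c d) (hα : ContinuousOn α (uIcc a b))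
    (hm : MapsTo α (uIcc a b) (uIcc c d)) :
    logChange (fun s => F (α s)) a b = logChange F (α a) (α b) := by
  obtain ⟨L, hL⟩ := h.exists_isLogLift
  have hLα : IsLogLift (fun s => F (α s)) a b (L ∘ α) :=
    ⟨hL.continuousOn.comp hα hm, fun x hx => hL.exp_eq _ (hm hx)⟩
  rw [hLα.logChange_eq, Function.comp_apply, Function.comp_apply,
    (hL.mono (uIcc_subset_uIcc (hm left_mem_uIcc) (hm right_mem_uIcc))).logChange_eq]

theorem logChange_neg (h : NonvanishingOn F a b) :
    logChange (fun s => -F s) a b = logChange F a b := by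
  obtain ⟨L, hL⟩ := h.exists_isLogLift
  have hL' : IsLogLift (fun s => -F s) a b (fun s => L s + π * I) :=
    ⟨hL.continuousOn.add continuousOn_const, fun x hx => by
      rw [exp_add, hL.exp_eq x hx, exp_pi_mul_I, mul_neg_one]⟩
  rw [hL'.logChange_eq, hL.logChange_eq, add_sub_add_right_eq_sub]

theorem logChange_eq_log_sub_log (hF : ContinuousOn F (uIcc a b))
    (h : ∀ x ∈ uIcc a b, F x ∈ slitPlane) : logChange F a b = log (F b) - log (F a) := by
  have : IsLogLift F a b (fun s => log (F s)) :=
    ⟨hF.clog h, fun x hx => exp_log (slitPlane_ne_zero (h x hx))⟩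
  exact this.logChange_eq

end LogChange

/-! ### Parity of integral multiples of `2πi` -/

section TurnParity

open Complex
open scoped Real

/-- `x` is an integral multiple `2πik` of `2πi`, and `ε` is the residue of `k` modulo two. -/
def HasTurnParity (x : ℂ) (ε : ZMod 2) : Prop :=
  ∃ k : ℤ, (k : ZMod 2) = ε ∧ x = k * (2 * π * I)

variable {x y : ℂ} {ε δ : ZMod 2}

theorem hasTurnParity_zero : HasTurnParity 0 0 := ⟨0, by simp⟩

theorem hasTurnParity_two_pi_mul_I : HasTurnParity (2 * π * I) 1 := ⟨1, by simp⟩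

theorem HasTurnParity.add (hx : HasTurnParity x ε) (hy : HasTurnParity y δ) :
    HasTurnParity (x + y) (ε + δ) := by
  obtain ⟨k, rfl, rfl⟩ := hx
  obtain ⟨l, rfl, rfl⟩ := hy
  exact ⟨k + l, by push_cast; ring, by push_cast; ring⟩

theorem HasTurnParity.neg (hx : HasTurnParity x ε) : HasTurnParity (-x) ε := by
  obtain ⟨k, rfl, rfl⟩ := hx
  exact ⟨-k, by rw [Int.cast_neg, ZMod.neg_eq_self_mod_two], by push_cast; ring⟩

theorem HasTurnParity.sub (hx : HasTurnParity x ε) (hy : HasTurnParity y δ) :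
    HasTurnParity (x - y) (ε + δ) :=
  sub_eq_add_neg x y ▸ hx.add hy.neg

theorem HasTurnParity.unique (h : HasTurnParity x ε) (h' : HasTurnParity x δ) : ε = δ := by
  obtain ⟨k, rfl, hk⟩ := h
  obtain ⟨l, rfl, hl⟩ := h'
  have : (k : ℂ) = l := mul_right_cancel₀ two_pi_I_ne_zero (hk.symm.trans hl)
  rw [Int.cast_injective this]

theorem exists_hasTurnParity_sub (h : exp x = exp y) : ∃ ε, HasTurnParity (x - y) ε := by
  obtain ⟨n, hn⟩ := exp_eq_exp_iff_exists_int.1 h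
  exact ⟨n, n, rfl, by rw [hn, add_sub_cancel_left]⟩

end TurnParity

/-! ### The index of a rectangle -/

section RectIndex

open Complex Set
open scoped Real

/-- The change of the logarithm of `F` around the boundary of `[a, b] × [c, d]`. -/
noncomputable def rectIndex (F : ℝ → ℝ → ℂ) (a b c d : ℝ) : ℂ :=
  logChange (fun s => F s c) a b + logChange (F b) c d
    - logChange (fun s => F s d) a b - logChange (F a) c d

/-- `F` is continuous and has no zero on each side of the rectangle with opposite corners `(a, c)`
and `(b, d)`. -/
structure NonvanishingOnSides (F : ℝ → ℝ → ℂ) (a b c d : ℝ) : Prop where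
  bot : NonvanishingOn (fun s => F s c) a b
  top : NonvanishingOn (fun s => F s d) a b
  left : NonvanishingOn (F a) c d
  right : NonvanishingOn (F b) c d

theorem continuousOn_section_fst {F : ℝ → ℝ → ℂ} {S T : Set ℝ}
    (hF : ContinuousOn (Function.uncurry F) (S ×ˢ T)) {t : ℝ} (ht : t ∈ T) :
    ContinuousOn (fun s => F s t) S :=
  hF.comp (f := fun s => (s, t)) (by fun_prop) (fun _ hs => ⟨hs, ht⟩)

theorem continuousOn_section_snd {F : ℝ → ℝ → ℂ} {S T : Set ℝ}
    (hF : ContinuousOn (Function.uncurry F) (S ×ˢ T)) {s : ℝ} (hs : s ∈ S) :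
    ContinuousOn (F s) T :=
  hF.comp (f := fun t => (s, t)) (by fun_prop) (fun _ ht => ⟨hs, ht⟩)

variable {F G : ℝ → ℝ → ℂ} {a b c d m : ℝ}

theorem NonvanishingOnSides.of_continuousOn
    (hF : ContinuousOn (Function.uncurry F) (uIcc a b ×ˢ uIcc c d))
    (h1 : ∀ s ∈ uIcc a b, F s c ≠ 0 ∧ F s d ≠ 0) (h2 : ∀ t ∈ uIcc c d, F a t ≠ 0 ∧ F b t ≠ 0) :
    NonvanishingOnSides F a b c d where
  bot := ⟨continuousOn_section_fst hF left_mem_uIcc, fun s hs => (h1 s hs).1⟩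
  top := ⟨continuousOn_section_fst hF right_mem_uIcc, fun s hs => (h1 s hs).2⟩
  left := ⟨continuousOn_section_snd hF left_mem_uIcc, fun s hs => (h2 s hs).1⟩
  right := ⟨continuousOn_section_snd hF right_mem_uIcc, fun s hs => (h2 s hs).2⟩

theorem rectIndex_eq_zero (hF : ContinuousOn (Function.uncurry F) (uIcc a b ×ˢ uIcc c d))
    (h0 : ∀ s ∈ uIcc a b, ∀ t ∈ uIcc c d, F s t ≠ 0) : rectIndex F a b c d = 0 := by
  have : TopologicalLattice (ℝ × ℝ) :=
    { continuous_inf := by simp only [Prod.inf_def]; fun_prop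
      continuous_sup := by simp only [Prod.sup_def]; fun_prop }
  obtain ⟨L, hL, hexp⟩ : ∃ L : ℝ × ℝ → ℂ, ContinuousOn L (uIcc a b ×ˢ uIcc c d) ∧
      ∀ p ∈ uIcc a b ×ˢ uIcc c d, exp (L p) = Function.uncurry F p := by
    rw [uIcc_prod_uIcc] at hF ⊢
    exact exists_continuousOn_uIcc_exp_eq hF fun p hp => by
      rw [← uIcc_prod_uIcc] at hp
      exact h0 _ hp.1 _ hp.2
  have hfst : ∀ s ∈ uIcc a b, IsLogLift (F s) c d (fun t => L (s, t)) := fun s hs =>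
    ⟨continuousOn_section_snd (F := fun s t => L (s, t)) hL hs, fun t ht => hexp (s, t) ⟨hs, ht⟩⟩
  have hsnd : ∀ t ∈ uIcc c d, IsLogLift (fun s => F s t) a b (fun s => L (s, t)) := fun t ht =>
    ⟨continuousOn_section_fst (F := fun s t => L (s, t)) hL ht, fun s hs => hexp (s, t) ⟨hs, ht⟩⟩
  rw [rectIndex, (hfst a left_mem_uIcc).logChange_eq, (hfst b right_mem_uIcc).logChange_eq,
    (hsnd c left_mem_uIcc).logChange_eq, (hsnd d right_mem_uIcc).logChange_eq]
  ring

theorem rectIndex_congr (h : ∀ s ∈ uIcc a b, ∀ t ∈ uIcc c d, F s t = G s t) :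
    rectIndex F a b c d = rectIndex G a b c d := by
  simp only [rectIndex]
  rw [logChange_congr fun s hs => h s hs c left_mem_uIcc,
    logChange_congr fun s hs => h s hs d right_mem_uIcc,
    logChange_congr fun t ht => h a left_mem_uIcc t ht,
    logChange_congr fun t ht => h b right_mem_uIcc t ht]

theorem rectIndex_add_fst (h : NonvanishingOnSides F a b c d) (hm : m ∈ uIcc a b) :
    rectIndex F a m c d + rectIndex F m b c d = rectIndex F a b c d := by
  simp only [rectIndex]
  rw [← logChange_add_logChange h.bot hm, ← logChange_add_logChange h.top hm]
  ring

theorem rectIndex_symm_fst (F : ℝ → ℝ → ℂ) (a b c d : ℝ) :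
    rectIndex F b a c d = -rectIndex F a b c d := by
  simp only [rectIndex]
  rw [logChange_symm _ a b, logChange_symm _ a b]
  ring

theorem rectIndex_symm_snd (F : ℝ → ℝ → ℂ) (a b c d : ℝ) :
    rectIndex F a b d c = -rectIndex F a b c d := by
  simp only [rectIndex]
  rw [logChange_symm _ c d, logChange_symm _ c d]
  ring

theorem rectIndex_comp {α β : ℝ → ℝ} {a' b' c' d' : ℝ} (hα : ContinuousOn α (uIcc a b))
    (hβ : ContinuousOn β (uIcc c d)) (hmα : MapsTo α (uIcc a b) (uIcc a' b'))
    (hmβ : MapsTo β (uIcc c d) (uIcc c' d'))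
    (hbot : NonvanishingOn (fun u => G u (β c)) a' b')
    (htop : NonvanishingOn (fun u => G u (β d)) a' b')
    (hleft : NonvanishingOn (G (α a)) c' d') (hright : NonvanishingOn (G (α b)) c' d') :
    rectIndex (fun s t => G (α s) (β t)) a b c d = rectIndex G (α a) (α b) (β c) (β d) := by
  simp only [rectIndex]
  rw [logChange_comp hbot hα hmα, logChange_comp htop hα hmα, logChange_comp hleft hβ hmβ,
    logChange_comp hright hβ hmβ]

theorem rectIndex_eq_of_homotopy {H : ℝ → ℝ → ℝ → ℂ}
    (hc : ContinuousOn (fun p : ℝ × ℝ × ℝ => H p.1 p.2.1 p.2.2) (uIcc 0 1 ×ˢ uIcc a b ×ˢ uIcc c d))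
    (h1 : ∀ τ ∈ uIcc (0 : ℝ) 1, ∀ s ∈ uIcc a b, H τ s c ≠ 0 ∧ H τ s d ≠ 0)
    (h2 : ∀ τ ∈ uIcc (0 : ℝ) 1, ∀ t ∈ uIcc c d, H τ a t ≠ 0 ∧ H τ b t ≠ 0) :
    rectIndex (H 0) a b c d = rectIndex (H 1) a b c d := by
  have hfst : ∀ t ∈ uIcc c d, (∀ τ ∈ uIcc (0 : ℝ) 1, ∀ s ∈ uIcc a b, H τ s t ≠ 0) →
      rectIndex (fun τ s => H τ s t) 0 1 a b = 0 := fun t ht h =>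
    rectIndex_eq_zero (hc.comp (f := fun p : ℝ × ℝ => (p.1, p.2, t)) (by fun_prop)
      (fun p hp => ⟨hp.1, hp.2, ht⟩)) h
  have hsnd : ∀ s ∈ uIcc a b, (∀ τ ∈ uIcc (0 : ℝ) 1, ∀ t ∈ uIcc c d, H τ s t ≠ 0) →
      rectIndex (fun τ t => H τ s t) 0 1 c d = 0 := fun s hs h =>
    rectIndex_eq_zero (hc.comp (f := fun p : ℝ × ℝ => (p.1, s, p.2)) (by fun_prop)
      (fun p hp => ⟨hp.1, hs, hp.2⟩)) h
  have hbot := hfst c left_mem_uIcc fun τ hτ s hs => (h1 τ hτ s hs).1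
  have htop := hfst d right_mem_uIcc fun τ hτ s hs => (h1 τ hτ s hs).2
  have hleft := hsnd a left_mem_uIcc fun τ hτ s hs => (h2 τ hτ s hs).1
  have hright := hsnd b right_mem_uIcc fun τ hτ s hs => (h2 τ hτ s hs).2
  simp only [rectIndex] at hbot htop hleft hright ⊢
  linear_combination htop - hbot + hleft - hright

/- Opposite sides contribute equally, and half of the boundary joins a value to its negative: the
logarithm changes by an odd multiple of `πi` there. -/
theorem hasTurnParity_rectIndex_of_odd {r : ℝ} (hodd : ∀ u v, G (-u) (-v) = -G u v)
    (h : NonvanishingOnSides G (-r) r (-r) r) :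
    HasTurnParity (rectIndex G (-r) r (-r) r) 1 := by
  have hneg : MapsTo (fun s : ℝ => -s) (uIcc (-r) r) (uIcc (-r) r) := fun s hs => by
    rwa [← mem_neg, neg_uIcc, neg_neg, uIcc_comm]
  have opposite : ∀ {f g : ℝ → ℂ}, NonvanishingOn g (-r) r → (∀ s, f s = -g (-s)) →
      logChange f (-r) r = -logChange g (-r) r := fun {f g} hg hfg => by
    rw [funext hfg, logChange_neg (hg.comp continuous_neg.continuousOn hneg),
      logChange_comp hg continuous_neg.continuousOn hneg, neg_neg, logChange_symm]
  have htop : logChange (fun s => G s r) (-r) r = -logChange (fun s => G s (-r)) (-r) r :=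
    opposite h.bot fun s => by rw [hodd, neg_neg]
  have hleft : logChange (G (-r)) (-r) r = -logChange (G r) (-r) r :=
    opposite h.right fun s => by rw [← hodd, neg_neg]
  have hhalf : exp (logChange (fun s => G s (-r)) (-r) r + logChange (G r) (-r) r)
      = exp (π * I) := by
    have hmid : G r (-r) ≠ 0 := h.bot.ne_zero r right_mem_uIcc
    have hstart : G (-r) (-r) ≠ 0 := h.bot.ne_zero (-r) left_mem_uIcc
    have hend : G r r = -G (-r) (-r) := by rw [hodd, neg_neg]
    rw [exp_add, exp_logChange h.bot, exp_logChange h.right, exp_pi_mul_I, hend]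
    field_simp
  obtain ⟨ε, hε⟩ := exists_hasTurnParity_sub hhalf
  have htwo := (hε.add hε).add hasTurnParity_two_pi_mul_I
  rw [CharTwo.add_self_eq_zero ε, zero_add] at htwo
  convert htwo using 1
  rw [rectIndex, htop, hleft]
  ring

end RectIndex

/-! ### The index counts zeros modulo two -/

section RectZeros

open Set Topology Function

theorem exists_notMem_between {α : Type*} [LinearOrder α] [DenselyOrdered α] {S : Set α}
    (hfin : S.Finite) (h : S.Nontrivial) : ∃ m ∉ S, (∃ x ∈ S, x < m) ∧ ∃ y ∈ S, m < y := by
  obtain ⟨x, hx, y, hy, hxy⟩ := h.exists_lt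
  obtain ⟨m, ⟨hxm, hmy⟩, hm⟩ := ((Ioo_infinite hxy).sdiff hfin).nonempty
  exact ⟨m, hm, ⟨x, hx, hxm⟩, y, hy, hmy⟩

/-- The zeros of `F` in the rectangle `[a, b] × [c, d]`. -/
def rectZeros (F : ℝ → ℝ → ℂ) (a b c d : ℝ) : Set (ℝ × ℝ) :=
  {p ∈ Icc a b ×ˢ Icc c d | F p.1 p.2 = 0}

/-- Arbitrarily small rectangles around `(s, t)` have an odd index for `F`. -/
def HasOddLocalIndex (F : ℝ → ℝ → ℂ) (s t : ℝ) : Prop :=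
  ∀ U ∈ 𝓝 (s, t), ∃ a b c d, s ∈ Ioo a b ∧ t ∈ Ioo c d ∧ Icc a b ×ˢ Icc c d ⊆ U ∧
    HasTurnParity (rectIndex F a b c d) 1

variable {F : ℝ → ℝ → ℂ} {a b c d a' b' c' d' m : ℝ}

theorem rectZeros_mono (hs : Icc a' b' ⊆ Icc a b) (ht : Icc c' d' ⊆ Icc c d) :
    rectZeros F a' b' c' d' ⊆ rectZeros F a b c d :=
  fun _ hp => ⟨prod_mono hs ht hp.1, hp.2⟩

theorem rectZeros_union_fst (ham : a ≤ m) (hmb : m ≤ b) :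
    rectZeros F a m c d ∪ rectZeros F m b c d = rectZeros F a b c d := by
  ext p
  simp only [rectZeros, ← Icc_union_Icc_eq_Icc ham hmb, union_prod, mem_union, mem_ofPred_eq,
    or_and_right]

theorem disjoint_rectZeros (h : m ∉ Prod.fst '' rectZeros F a m c d) :
    Disjoint (rectZeros F a m c d) (rectZeros F m b c d) :=
  disjoint_left.2 fun p hp hp' => h ⟨p, hp, le_antisymm hp.1.1.2 hp'.1.1.1⟩

theorem NonvanishingOnSides.of_rectZeros_subset (hab : a ≤ b) (hcd : c ≤ d)
    (hF : ContinuousOn (uncurry F) (Icc a b ×ˢ Icc c d))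
    (h : rectZeros F a b c d ⊆ Ioo a b ×ˢ Ioo c d) : NonvanishingOnSides F a b c d := by
  rw [← uIcc_of_le hab, ← uIcc_of_le hcd] at hF
  refine .of_continuousOn hF ?_ ?_
  · rw [uIcc_of_le hab]
    exact fun s hs =>
      ⟨fun h0 => lt_irrefl c (h (a := (s, c)) ⟨⟨hs, left_mem_Icc.2 hcd⟩, h0⟩).2.1,
        fun h0 => lt_irrefl d (h (a := (s, d)) ⟨⟨hs, right_mem_Icc.2 hcd⟩, h0⟩).2.2⟩
  · rw [uIcc_of_le hcd]
    exact fun t ht =>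
      ⟨fun h0 => lt_irrefl a (h (a := (a, t)) ⟨⟨left_mem_Icc.2 hab, ht⟩, h0⟩).1.1,
        fun h0 => lt_irrefl b (h (a := (b, t)) ⟨⟨right_mem_Icc.2 hab, ht⟩, h0⟩).1.2⟩

theorem rectIndex_eq_zero_of_rectZeros_eq_empty (hab : a ≤ b) (hcd : c ≤ d)
    (hF : ContinuousOn (uncurry F) (Icc a b ×ˢ Icc c d)) (h : rectZeros F a b c d = ∅) :
    rectIndex F a b c d = 0 := by
  rw [← uIcc_of_le hab, ← uIcc_of_le hcd] at hF
  refine rectIndex_eq_zero hF ?_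
  rw [uIcc_of_le hab, uIcc_of_le hcd]
  exact fun s hs t ht h0 => eq_empty_iff_forall_notMem.1 h (s, t) ⟨⟨hs, ht⟩, h0⟩

theorem rectIndex_excise_fst (ha : a ≤ a') (hab : a' ≤ b') (hb : b' ≤ b) (hcd : c ≤ d)
    (hF : ContinuousOn (uncurry F) (Icc a b ×ˢ Icc c d))
    (h : rectZeros F a b c d ⊆ Ioo a' b' ×ˢ Ioo c d) :
    rectIndex F a b c d = rectIndex F a' b' c d := by
  have hsides : NonvanishingOnSides F a b c d := .of_rectZeros_subset
    (ha.trans (hab.trans hb)) hcd hF (h.trans (prod_mono (Ioo_subset_Ioo ha hb) subset_rfl))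
  have hsub : Icc a' b ⊆ Icc a b := Icc_subset_Icc ha le_rfl
  have hsides' : NonvanishingOnSides F a' b c d := .of_rectZeros_subset (hab.trans hb) hcd
    (hF.mono (prod_mono hsub subset_rfl)) ((rectZeros_mono hsub subset_rfl).trans
      (h.trans (prod_mono (Ioo_subset_Ioo le_rfl hb) subset_rfl)))
  have hleft : rectIndex F a a' c d = 0 := by
    have hsub : Icc a a' ⊆ Icc a b := Icc_subset_Icc le_rfl (hab.trans hb)
    exact rectIndex_eq_zero_of_rectZeros_eq_empty ha hcd (hF.mono (prod_mono hsub subset_rfl))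
      (eq_empty_of_forall_notMem fun p hp =>
        hp.1.1.2.not_gt (h (rectZeros_mono hsub subset_rfl hp)).1.1)
  have hright : rectIndex F b' b c d = 0 := by
    have hsub : Icc b' b ⊆ Icc a b := Icc_subset_Icc (ha.trans hab) le_rfl
    exact rectIndex_eq_zero_of_rectZeros_eq_empty hb hcd (hF.mono (prod_mono hsub subset_rfl))
      (eq_empty_of_forall_notMem fun p hp =>
        hp.1.1.1.not_gt (h (rectZeros_mono hsub subset_rfl hp)).1.2)
  rw [← rectIndex_add_fst hsides (mem_uIcc_of_le ha (hab.trans hb)), hleft, zero_add,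
    ← rectIndex_add_fst hsides' (mem_uIcc_of_le hab hb), hright, add_zero]

theorem rectIndex_flip (F : ℝ → ℝ → ℂ) (a b c d : ℝ) :
    rectIndex (flip F) c d a b = -rectIndex F a b c d := by
  simp only [rectIndex, flip_def]
  ring

theorem rectIndex_excise (ha : a ≤ a') (hab : a' ≤ b') (hb : b' ≤ b) (hc : c ≤ c')
    (hcd : c' ≤ d') (hd : d' ≤ d) (hF : ContinuousOn (uncurry F) (Icc a b ×ˢ Icc c d))
    (h : rectZeros F a b c d ⊆ Ioo a' b' ×ˢ Ioo c' d') :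
    rectIndex F a b c d = rectIndex F a' b' c' d' := by
  have hsub : Icc a' b' ⊆ Icc a b := Icc_subset_Icc ha hb
  have hflip : ContinuousOn (uncurry (flip F)) (Icc c d ×ˢ Icc a' b') :=
    hF.comp continuous_swap.continuousOn fun _ hp => ⟨hsub hp.2, hp.1⟩
  have hzeros : rectZeros (flip F) c d a' b' ⊆ Ioo c' d' ×ˢ Ioo a' b' := fun p hp =>
    (h (a := p.swap) ⟨⟨hsub hp.1.2, hp.1.1⟩, hp.2⟩).symm
  rw [rectIndex_excise_fst ha hab hb (hc.trans (hcd.trans hd)) hF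
    (h.trans (prod_mono subset_rfl (Ioo_subset_Ioo hc hd))), ← neg_inj, ← rectIndex_flip,
    ← rectIndex_flip, rectIndex_excise_fst hc hcd hd hab hflip hzeros]

theorem hasTurnParity_rectIndex_of_rectZeros_eq_singleton {p : ℝ × ℝ}
    (hF : ContinuousOn (uncurry F) (Icc a b ×ˢ Icc c d)) (hp : p ∈ Ioo a b ×ˢ Ioo c d)
    (h : rectZeros F a b c d = {p}) (hloc : HasOddLocalIndex F p.1 p.2) :
    HasTurnParity (rectIndex F a b c d) 1 := by
  obtain ⟨a', b', c', d', hs, ht, hsub, hodd⟩ := hloc _ ((isOpen_Ioo.prod isOpen_Ioo).mem_nhds hp)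
  have hab : a' ≤ b' := (hs.1.trans hs.2).le
  have hcd : c' ≤ d' := (ht.1.trans ht.2).le
  obtain ⟨ha, hc⟩ := hsub (a := (a', c')) ⟨left_mem_Icc.2 hab, left_mem_Icc.2 hcd⟩
  obtain ⟨hb, hd⟩ := hsub (a := (b', d')) ⟨right_mem_Icc.2 hab, right_mem_Icc.2 hcd⟩
  rwa [rectIndex_excise ha.1.le hab hb.2.le hc.1.le hcd hd.2.le hF
    (h ▸ singleton_subset_iff.2 ⟨hs, ht⟩)]

/- Induction on the number of zeros: a vertical line through no zero separates two of them. -/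
theorem hasTurnParity_rectIndex_ncard_rectZeros (hab : a ≤ b) (hcd : c ≤ d)
    (hF : ContinuousOn (uncurry F) (Icc a b ×ˢ Icc c d)) (hfin : (rectZeros F a b c d).Finite)
    (hinj : InjOn Prod.fst (rectZeros F a b c d))
    (hint : rectZeros F a b c d ⊆ Ioo a b ×ˢ Ioo c d)
    (hloc : ∀ p ∈ rectZeros F a b c d, HasOddLocalIndex F p.1 p.2) :
    HasTurnParity (rectIndex F a b c d) (rectZeros F a b c d).ncard := by
  induction hn : (rectZeros F a b c d).ncard using Nat.strong_induction_on generalizing a b with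
  | _ n ih =>
  obtain rfl | rfl | hlt : n = 0 ∨ n = 1 ∨ 1 < n := by lia
  · rw [ncard_eq_zero hfin] at hn
    rw [rectIndex_eq_zero_of_rectZeros_eq_empty hab hcd hF hn, Nat.cast_zero]
    exact hasTurnParity_zero
  · obtain ⟨p, hp⟩ := ncard_eq_one.1 hn
    have hmem : p ∈ rectZeros F a b c d := hp ▸ mem_singleton p
    rw [Nat.cast_one]
    exact hasTurnParity_rectIndex_of_rectZeros_eq_singleton hF (hint hmem) hp (hloc p hmem)
  · obtain ⟨x, y, hx, hy, hxy⟩ := (one_lt_ncard_iff hfin).1 (hn ▸ hlt)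
    have hnontrivial : (rectZeros F a b c d).Nontrivial := ⟨x, hx, y, hy, hxy⟩
    obtain ⟨m, hm, ⟨_, ⟨p, hp, rfl⟩, hpm⟩, _, ⟨q, hq, rfl⟩, hmq⟩ :=
      exists_notMem_between (hfin.image Prod.fst) (hnontrivial.image_of_injOn hinj)
    have ham : a ≤ m := hp.1.1.1.trans hpm.le
    have hmb : m ≤ b := hmq.le.trans hq.1.1.2
    have hl : Icc a m ⊆ Icc a b := Icc_subset_Icc le_rfl hmb
    have hr : Icc m b ⊆ Icc a b := Icc_subset_Icc ham le_rfl
    have hzl : rectZeros F a m c d ⊆ rectZeros F a b c d := rectZeros_mono hl subset_rfl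
    have hzr : rectZeros F m b c d ⊆ rectZeros F a b c d := rectZeros_mono hr subset_rfl
    have hcard := ncard_union_eq (disjoint_rectZeros (b := b) fun h => hm (image_mono hzl h))
      (hfin.subset hzl) (hfin.subset hzr)
    have hposl : 0 < (rectZeros F a m c d).ncard :=
      (ncard_pos (hfin.subset hzl)).2 ⟨p, ⟨⟨hp.1.1.1, hpm.le⟩, hp.1.2⟩, hp.2⟩
    have hposr : 0 < (rectZeros F m b c d).ncard :=
      (ncard_pos (hfin.subset hzr)).2 ⟨q, ⟨⟨hmq.le, hq.1.1.2⟩, hq.1.2⟩, hq.2⟩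
    rw [rectZeros_union_fst ham hmb, hn] at hcard
    rw [← rectIndex_add_fst (.of_rectZeros_subset hab hcd hF hint) (mem_uIcc_of_le ham hmb),
      hcard, Nat.cast_add]
    refine (ih _ (by lia) ham (hF.mono (prod_mono hl subset_rfl)) (hfin.subset hzl)
      (hinj.mono hzl) (fun z hz => ?_) (fun z hz => hloc z (hzl hz)) rfl).add
      (ih _ (by lia) hmb (hF.mono (prod_mono hr subset_rfl)) (hfin.subset hzr)
      (hinj.mono hzr) (fun z hz => ?_) (fun z hz => hloc z (hzr hz)) rfl)
    · exact ⟨⟨(hint (hzl hz)).1.1, hz.1.1.2.lt_of_ne fun h => hm ⟨z, hzl hz, h⟩⟩, (hint (hzl hz)).2⟩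
    · exact ⟨⟨hz.1.1.1.lt_of_ne fun h => hm ⟨z, hzr hz, h.symm⟩, (hint (hzr hz)).1.2⟩,
        (hint (hzr hz)).2⟩

end RectZeros

/-! ### The local index at a proper crossing -/

section ProperCrossing

open Complex Set Metric Topology

/-- The point `(1 - τ / 2) z - (τ / 2) w`. As `τ` grows from `0` to `1`, the points `slide τ z w`
and `slide τ w z` move from `z` and `w` to two opposite points with constant difference `z - w`. -/
noncomputable def slide (τ : ℝ) (z w : ℂ) : ℂ := (1 - τ / 2 : ℝ) • z - (τ / 2 : ℝ) • w

/-- The difference of the images under `ψ` of `u` on the real and of `iv` on the imaginary axis. -/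
noncomputable def axesDiff (ψ : ℂ → ℂ) (u v : ℝ) : ℂ := ψ u - ψ (I * v)

/-- A homotopy from `axesDiff ψ` to an odd function of `(u, v)`. -/
noncomputable def axesHomotopy (ψ : ℂ → ℂ) (τ u v : ℝ) : ℂ :=
  ψ (slide τ u (I * v)) - ψ (slide τ (I * v) u)

theorem slide_mem_ball {τ ρ : ℝ} {z w : ℂ} (hτ : τ ∈ Icc (0 : ℝ) 1) (hz : z ∈ ball 0 ρ)
    (hw : w ∈ ball 0 ρ) : slide τ z w ∈ ball 0 ρ := by
  rw [slide, sub_eq_add_neg, ← smul_neg]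
  exact convex_ball 0 ρ hz (by simpa using hw) (by linarith [hτ.2]) (by linarith [hτ.1]) (by ring)

theorem eq_of_slide_eq {τ : ℝ} {z w : ℂ} (h : slide τ z w = slide τ w z) : z = w := by
  simp only [slide, real_smul] at h
  push_cast at h
  linear_combination h

theorem ofReal_eq_I_mul_iff {u v : ℝ} : (u : ℂ) = I * v ↔ u = 0 ∧ v = 0 := by
  simp [Complex.ext_iff, eq_comm]

theorem axesHomotopy_zero (ψ : ℂ → ℂ) : axesHomotopy ψ 0 = axesDiff ψ := by
  funext u v
  simp [axesHomotopy, axesDiff, slide]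

theorem axesHomotopy_one_neg (ψ : ℂ → ℂ) (u v : ℝ) :
    axesHomotopy ψ 1 (-u) (-v) = -axesHomotopy ψ 1 u v := by
  simp only [axesHomotopy, slide, real_smul]
  rw [neg_sub]
  congr 2 <;> (push_cast; ring)

variable {ψ : ℂ → ℂ} {ρ r : ℝ}

theorem axes_mem_ball (hr : r < ρ) {u v : ℝ} (hu : u ∈ Icc (-r) r) (hv : v ∈ Icc (-r) r) :
    (u : ℂ) ∈ ball 0 ρ ∧ I * v ∈ ball 0 ρ := by
  simpa using And.intro ((abs_le.2 hu).trans_lt hr) ((abs_le.2 hv).trans_lt hr)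

theorem continuousOn_axesHomotopy (hψ : ContinuousOn ψ (ball 0 ρ)) (hr : r < ρ) :
    ContinuousOn (fun p : ℝ × ℝ × ℝ => axesHomotopy ψ p.1 p.2.1 p.2.2)
      (Icc 0 1 ×ˢ Icc (-r) r ×ˢ Icc (-r) r) := by
  unfold axesHomotopy slide
  refine .sub (hψ.comp (by fun_prop) fun p hp => ?_) (hψ.comp (by fun_prop) fun p hp => ?_)
  all_goals have hball := axes_mem_ball hr hp.2.1 hp.2.2
  · exact slide_mem_ball hp.1 hball.1 hball.2
  · exact slide_mem_ball hp.1 hball.2 hball.1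

theorem axesHomotopy_ne_zero (hψ : InjOn ψ (ball 0 ρ)) (hr : r < ρ) {τ u v : ℝ}
    (hτ : τ ∈ Icc (0 : ℝ) 1) (hu : u ∈ Icc (-r) r) (hv : v ∈ Icc (-r) r) (huv : u ≠ 0 ∨ v ≠ 0) :
    axesHomotopy ψ τ u v ≠ 0 := fun h => by
  obtain ⟨hu, hv⟩ := axes_mem_ball hr hu hv
  have := ofReal_eq_I_mul_iff.1 (eq_of_slide_eq
    (hψ (slide_mem_ball hτ hu hv) (slide_mem_ball hτ hv hu) (sub_eq_zero.1 h)))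
  tauto

theorem nonvanishingOnSides_axesHomotopy (hψ : ContinuousOn ψ (ball 0 ρ))
    (hinj : InjOn ψ (ball 0 ρ)) (hr : r < ρ) {τ u u' v v' : ℝ} (hτ : τ ∈ Icc (0 : ℝ) 1)
    (hu : u ∈ Icc (-r) r \ {0}) (hu' : u' ∈ Icc (-r) r \ {0}) (hv : v ∈ Icc (-r) r \ {0})
    (hv' : v' ∈ Icc (-r) r \ {0}) : NonvanishingOnSides (axesHomotopy ψ τ) u u' v v' := by
  have hsubu : uIcc u u' ⊆ Icc (-r) r := uIcc_subset_Icc hu.1 hu'.1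
  have hsubv : uIcc v v' ⊆ Icc (-r) r := uIcc_subset_Icc hv.1 hv'.1
  refine .of_continuousOn ?_ (fun s hs => ⟨?_, ?_⟩) (fun t ht => ⟨?_, ?_⟩)
  · exact (continuousOn_axesHomotopy hψ hr).comp (f := fun p : ℝ × ℝ => (τ, p)) (by fun_prop)
      fun p hp => ⟨hτ, hsubu hp.1, hsubv hp.2⟩
  · exact axesHomotopy_ne_zero hinj hr hτ (hsubu hs) hv.1 (.inr hv.2)
  · exact axesHomotopy_ne_zero hinj hr hτ (hsubu hs) hv'.1 (.inr hv'.2)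
  · exact axesHomotopy_ne_zero hinj hr hτ hu.1 (hsubv ht) (.inl hu.2)
  · exact axesHomotopy_ne_zero hinj hr hτ hu'.1 (hsubv ht) (.inl hu'.2)

theorem hasTurnParity_rectIndex_axesDiff (hψ : ContinuousOn ψ (ball 0 ρ))
    (hinj : InjOn ψ (ball 0 ρ)) (hr0 : 0 < r) (hr : r < ρ) :
    HasTurnParity (rectIndex (axesDiff ψ) (-r) r (-r) r) 1 := by
  have hle : -r ≤ r := by linarith
  have hmem : r ∈ Icc (-r) r \ {0} := ⟨right_mem_Icc.2 hle, hr0.ne'⟩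
  have hmem' : -r ∈ Icc (-r) r \ {0} := ⟨left_mem_Icc.2 hle, neg_ne_zero.2 hr0.ne'⟩
  have hsides : ∀ τ ∈ Icc (0 : ℝ) 1, NonvanishingOnSides (axesHomotopy ψ τ) (-r) r (-r) r :=
    fun τ hτ => nonvanishingOnSides_axesHomotopy hψ hinj hr hτ hmem' hmem hmem' hmem
  rw [← axesHomotopy_zero, rectIndex_eq_of_homotopy (H := axesHomotopy ψ)]
  · exact hasTurnParity_rectIndex_of_odd (axesHomotopy_one_neg ψ)
      (hsides 1 (right_mem_Icc.2 zero_le_one))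
  · rw [uIcc_of_le hle, uIcc_of_le zero_le_one]
    exact continuousOn_axesHomotopy hψ hr
  · rw [uIcc_of_le zero_le_one]
    exact fun τ hτ s hs => ⟨(hsides τ hτ).bot.ne_zero s hs, (hsides τ hτ).top.ne_zero s hs⟩
  · rw [uIcc_of_le zero_le_one]
    exact fun τ hτ t ht => ⟨(hsides τ hτ).left.ne_zero t ht, (hsides τ hτ).right.ne_zero t ht⟩

/-- `α` maps `[a, b]` continuously into `[-r, r]` and its endpoints to opposite endpoints. -/
structure CrossesInterval (α : ℝ → ℝ) (a b r : ℝ) : Prop where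
  continuousOn : ContinuousOn α (Icc a b)
  mapsTo : MapsTo α (Icc a b) (Icc (-r) r)
  ends : α a = -r ∧ α b = r ∨ α a = r ∧ α b = -r

theorem hasTurnParity_rectIndex_axesDiff_comp {α β : ℝ → ℝ} {a b c d : ℝ}
    (hψ : ContinuousOn ψ (ball 0 ρ)) (hinj : InjOn ψ (ball 0 ρ)) (hr0 : 0 < r) (hr : r < ρ)
    (hab : a ≤ b) (hcd : c ≤ d) (hα : CrossesInterval α a b r) (hβ : CrossesInterval β c d r) :
    HasTurnParity (rectIndex (fun s t => axesDiff ψ (α s) (β t)) a b c d) 1 := by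
  have hle : -r ≤ r := by linarith
  have hend : ∀ {x y : ℝ}, x = -r ∧ y = r ∨ x = r ∧ y = -r →
      x ∈ Icc (-r) r \ {0} ∧ y ∈ Icc (-r) r \ {0} := by
    rintro x y (⟨rfl, rfl⟩ | ⟨rfl, rfl⟩) <;> simp [hr0.ne', hle]
  have hmem : r ∈ Icc (-r) r \ {0} := ⟨right_mem_Icc.2 hle, hr0.ne'⟩
  have hmem' : -r ∈ Icc (-r) r \ {0} := ⟨left_mem_Icc.2 hle, neg_ne_zero.2 hr0.ne'⟩
  have h0 : (0 : ℝ) ∈ Icc (0 : ℝ) 1 := left_mem_Icc.2 zero_le_one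
  have hrows := nonvanishingOnSides_axesHomotopy hψ hinj hr h0 hmem' hmem
    (hend hβ.ends).1 (hend hβ.ends).2
  have hcols := nonvanishingOnSides_axesHomotopy hψ hinj hr h0 (hend hα.ends).1 (hend hα.ends).2
    hmem' hmem
  rw [axesHomotopy_zero] at hrows hcols
  have hsquare := hasTurnParity_rectIndex_axesDiff hψ hinj hr0 hr
  rw [rectIndex_comp (uIcc_of_le hab ▸ hα.continuousOn) (uIcc_of_le hcd ▸ hβ.continuousOn)
    (uIcc_of_le hab ▸ uIcc_of_le hle ▸ hα.mapsTo) (uIcc_of_le hcd ▸ uIcc_of_le hle ▸ hβ.mapsTo)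
    hrows.bot hrows.top hcols.left hcols.right]
  obtain ⟨ha, hb⟩ | ⟨ha, hb⟩ := hα.ends <;> obtain ⟨hc, hd⟩ | ⟨hc, hd⟩ := hβ.ends <;>
    rw [ha, hb, hc, hd]
  · exact hsquare
  · exact rectIndex_symm_snd _ (-r) r (-r) r ▸ hsquare.neg
  · exact rectIndex_symm_fst _ (-r) r (-r) r ▸ hsquare.neg
  · rw [rectIndex_symm_fst, rectIndex_symm_snd, neg_neg]
    exact hsquare

theorem exists_crossesInterval_of_strictMonoOn {α : ℝ → ℝ} {p q x₀ : ℝ} (hx₀ : x₀ ∈ Ioo p q)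
    (hα : ContinuousOn α (Icc p q)) (hmono : StrictMonoOn α (Icc p q)) (h0 : α x₀ = 0) :
    ∀ᶠ r in 𝓝[>] 0, ∃ a b, x₀ ∈ Ioo a b ∧ Icc a b ⊆ Icc p q ∧ CrossesInterval α a b r := by
  have hx₀' : x₀ ∈ Icc p q := Ioo_subset_Icc_self hx₀
  have hp : p ∈ Icc p q := left_mem_Icc.2 (hx₀.1.trans hx₀.2).le
  have hq : q ∈ Icc p q := right_mem_Icc.2 (hx₀.1.trans hx₀.2).le
  have hαp : 0 < -α p := by linarith [hmono hp hx₀' hx₀.1]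
  have hαq : 0 < α q := by linarith [hmono hx₀' hq hx₀.2]
  filter_upwards [Ioo_mem_nhdsGT hαp, Ioo_mem_nhdsGT hαq] with r hrp hrq
  obtain ⟨a, ha, har⟩ : -r ∈ α '' Icc p x₀ :=
    intermediate_value_Icc hx₀.1.le (hα.mono (Icc_subset_Icc le_rfl hx₀.2.le))
      ⟨by linarith [hrp.2], by linarith [hrp.1]⟩
  obtain ⟨b, hb, hbr⟩ : r ∈ α '' Icc x₀ q :=
    intermediate_value_Icc hx₀.2.le (hα.mono (Icc_subset_Icc hx₀.1.le le_rfl))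
      ⟨by linarith [hrp.1], hrq.2.le⟩
  have hsub : Icc a b ⊆ Icc p q := Icc_subset_Icc ha.1 hb.2
  have hab : a ≤ b := ha.2.trans hb.1
  refine ⟨a, b, ⟨ha.2.lt_of_ne ?_, hb.1.lt_of_ne ?_⟩, hsub, hα.mono hsub, fun x hx => ?_,
    .inl ⟨har, hbr⟩⟩
  · rintro rfl
    linarith [hrp.1]
  · rintro rfl
    linarith [hrp.1]
  · exact ⟨har ▸ hmono.monotoneOn (hsub (left_mem_Icc.2 hab)) (hsub hx) hx.1,
      hbr ▸ hmono.monotoneOn (hsub hx) (hsub (right_mem_Icc.2 hab)) hx.2⟩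

theorem CrossesInterval.of_neg {α : ℝ → ℝ} {a b : ℝ} (h : CrossesInterval (-α) a b r) :
    CrossesInterval α a b r where
  continuousOn := by simpa using h.continuousOn.neg
  mapsTo x hx := ⟨by linarith [(h.mapsTo hx).2, Pi.neg_apply α x],
    by linarith [(h.mapsTo hx).1, Pi.neg_apply α x]⟩
  ends := by simpa [neg_eq_iff_eq_neg, or_comm] using h.ends

theorem exists_crossesInterval {α : ℝ → ℝ} {N : Set ℝ} {x₀ : ℝ} (hN : N ∈ 𝓝 x₀)
    (hα : ContinuousOn α N) (hinj : InjOn α N) (h0 : α x₀ = 0) :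
    ∀ᶠ r in 𝓝[>] 0, ∃ a b, x₀ ∈ Ioo a b ∧ Icc a b ⊆ N ∧ CrossesInterval α a b r := by
  obtain ⟨p, q, -, hpq, hsub⟩ := exists_Icc_mem_subset_of_mem_nhds hN
  rw [Icc_mem_nhds_iff] at hpq
  rcases (hα.mono hsub).strictMonoOn_of_injOn_Icc' (hpq.1.trans hpq.2).le (hinj.mono hsub) with
    hmono | hanti
  · filter_upwards [exists_crossesInterval_of_strictMonoOn hpq (hα.mono hsub) hmono h0]
    rintro r ⟨a, b, hx₀, hab, hcross⟩
    exact ⟨a, b, hx₀, hab.trans hsub, hcross⟩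
  · filter_upwards [exists_crossesInterval_of_strictMonoOn (α := -α) hpq (hα.mono hsub).neg
      hanti.neg (by simp [h0])]
    rintro r ⟨a, b, hx₀, hab, hcross⟩
    exact ⟨a, b, hx₀, hab.trans hsub, hcross.of_neg⟩

theorem exists_axis_coordinate {φ : OpenPartialHomeomorph ℂ ℂ} {h : ℝ → ℂ} {N : Set ℝ} {x₀ : ℝ}
    {w : ℂ} (hN : N ∈ 𝓝 x₀) (hh : ContinuousOn h N) (hinj : InjOn h N) (hsrc : h x₀ ∈ φ.source)
    (h0 : φ (h x₀) = 0) (haxis : ∀ x ∈ N, h x ∈ φ.source → φ (h x) = w * (φ (h x) / w).re) :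
    ∃ α : ℝ → ℝ, ∀ᶠ r in 𝓝[>] 0, ∃ a b, x₀ ∈ Ioo a b ∧ Icc a b ⊆ N ∧
      CrossesInterval α a b r ∧ ∀ x ∈ Icc a b, h x = φ.symm (w * α x) := by
  let α : ℝ → ℝ := fun x => (φ (h x) / w).re
  have hN' : N ∩ h ⁻¹' φ.source ∈ 𝓝 x₀ := Filter.inter_mem hN
    ((hh.continuousAt hN).preimage_mem_nhds (φ.open_source.mem_nhds hsrc))
  have hα : ContinuousOn α (N ∩ h ⁻¹' φ.source) := continuous_re.comp_continuousOn
    ((φ.continuousOn.comp (hh.mono inter_subset_left) fun _ hx => hx.2).div_const w)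
  have hαinj : InjOn α (N ∩ h ⁻¹' φ.source) := fun x hx y hy hxy => by
    refine hinj hx.1 hy.1 (φ.injOn hx.2 hy.2 ?_)
    rw [haxis x hx.1 hx.2, haxis y hy.1 hy.2]
    exact congrArg (fun u : ℝ => w * u) hxy
  refine ⟨α, (exists_crossesInterval hN' hα hαinj (by simp [α, h0])).mono ?_⟩
  rintro r ⟨a, b, hx₀, hab, hcross⟩
  refine ⟨a, b, hx₀, hab.trans inter_subset_left, hcross, fun x hx => ?_⟩
  rw [← haxis x (hab hx).1 (hab hx).2, φ.left_inv (hab hx).2]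

theorem hasOddLocalIndex_of_isProperCrossing {f g : ℝ → ℂ} {A B : Set ℂ} {S T : Set ℝ} {s₀ t₀ : ℝ}
    (hS : S ∈ 𝓝 s₀) (hT : T ∈ 𝓝 t₀) (hf : ContinuousOn f S) (hg : ContinuousOn g T)
    (hfi : InjOn f S) (hgi : InjOn g T) (hfA : MapsTo f S A) (hgB : MapsTo g T B)
    (heq : f s₀ = g t₀) (hX : IsProperCrossing A B (f s₀)) :
    HasOddLocalIndex (fun s t => f s - g t) s₀ t₀ := by
  intro U hU
  obtain ⟨U₁, hU₁, U₂, hU₂, hUsub⟩ := mem_nhds_prod_iff.1 hU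
  obtain ⟨φ, hsrc, h0, hφ⟩ := hX
  obtain ⟨ρ, hρ, hball⟩ := isOpen_iff.1 φ.open_target 0 (h0 ▸ φ.map_source hsrc)
  obtain ⟨α, hα⟩ := exists_axis_coordinate (w := 1) (Filter.inter_mem hS hU₁)
    (hf.mono inter_subset_left) (hfi.mono inter_subset_left) hsrc h0 fun s hs hs' => by
      have him : (φ (f s)).im = 0 := (hφ _ hs').1.1 (hfA hs.1)
      apply Complex.ext <;> simp [him]
  obtain ⟨β, hβ⟩ := exists_axis_coordinate (w := I) (Filter.inter_mem hT hU₂)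
    (hg.mono inter_subset_left) (hgi.mono inter_subset_left) (heq ▸ hsrc) (heq ▸ h0)
    fun t ht ht' => by
      have hre : (φ (g t)).re = 0 := (hφ _ ht').2.1 (hgB ht.1)
      apply Complex.ext <;> simp [hre]
  obtain ⟨r, ⟨a, b, hs₀, hab, hcrossα, hfα⟩, ⟨c, d, ht₀, hcd, hcrossβ, hgβ⟩, hr0, hr⟩ :=
    (hα.and (hβ.and (Ioo_mem_nhdsGT hρ))).exists
  have hle : a ≤ b := (hs₀.1.trans hs₀.2).le
  have hle' : c ≤ d := (ht₀.1.trans ht₀.2).le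
  refine ⟨a, b, c, d, hs₀, ht₀, fun p hp => hUsub ⟨(hab hp.1).2, (hcd hp.2).2⟩, ?_⟩
  have hcongr : rectIndex (fun s t => f s - g t) a b c d =
      rectIndex (fun s t => axesDiff φ.symm (α s) (β t)) a b c d := by
    refine rectIndex_congr fun s hs t ht => ?_
    rw [hfα s (uIcc_of_le hle ▸ hs), hgβ t (uIcc_of_le hle' ▸ ht), one_mul, axesDiff]
  rw [hcongr]
  exact hasTurnParity_rectIndex_axesDiff_comp (φ.continuousOn_symm.mono hball)
    (φ.symm.injOn.mono hball) hr0 hr hle hle' hcrossα hcrossβ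

end ProperCrossing

/-! ### Crossing parities of a drawing -/

section CrossingParity

open Complex Set Topology
open scoped Real

/-- `f` parametrizes the arc `S` from the point of `a` to the point of `b`. -/
structure IsArcParam {V : Type*} (vert : V → ℂ) (S : Set ℂ) (f : ℝ → ℂ) (a b : V) : Prop where
  continuous : Continuous f
  injOn : InjOn f (Icc 0 1)
  image : f '' Icc 0 1 = S
  zero : f 0 = vert a
  one : f 1 = vert b

/-- The change of the logarithm along `f`, seen from the point of `v`, differs from the difference
of the principal logarithms at the points of `b` and `a` by a number of full turns of parity `ε`. -/
def HasTurns {V : Type*} (vert : V → ℂ) (f : ℝ → ℂ) (a b v : V) (ε : ZMod 2) : Prop :=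
  HasTurnParity (logChange (fun s => f s - vert v) 0 1 -
    (log (vert b - vert v) - log (vert a - vert v))) ε

/-- `t u v` is the parity of the number of full turns by which the principal logarithms of the two
directions between the points of `u` and `v` fail to differ by `π I`. -/
def IsFlip {V : Type*} (vert : V → ℂ) (t : V → V → ZMod 2) : Prop :=
  ∀ u v, u ≠ v →
    HasTurnParity (log (vert v - vert u) - log (vert u - vert v) - π * I) (t u v)

variable {V : Type*} {vert : V → ℂ} {S T : Set ℂ} {f g : ℝ → ℂ} {a b c d v : V}
  {t : V → V → ZMod 2}

theorem exists_isFlip (h : Function.Injective vert) : ∃ t, IsFlip vert t := by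
  have hpar (u v : V) : ∃ ε, u ≠ v →
      HasTurnParity (log (vert v - vert u) - log (vert u - vert v) - π * I) ε := by
    obtain rfl | huv := eq_or_ne u v
    · exact ⟨0, fun h => absurd rfl h⟩
    have h1 : vert v - vert u ≠ 0 := sub_ne_zero.2 (h.ne huv.symm)
    have h2 : vert u - vert v ≠ 0 := sub_ne_zero.2 (h.ne huv)
    obtain ⟨ε, hε⟩ := exists_hasTurnParity_sub
      (x := log (vert v - vert u) - log (vert u - vert v)) (y := π * I) (by
        rw [exp_sub, exp_log h1, exp_log h2, exp_pi_mul_I, ← neg_sub (vert u), neg_div,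
          div_self h2])
    exact ⟨ε, fun _ => hε⟩
  choose t ht using hpar
  exact ⟨t, ht⟩

theorem IsFlip.add_eq_one (h : IsFlip vert t) {u v : V} (huv : u ≠ v) : t u v + t v u = 1 := by
  refine HasTurnParity.unique ?_ hasTurnParity_two_pi_mul_I.neg
  have hsum := (h u v huv).add (h v u huv.symm)
  ring_nf at hsum ⊢
  exact hsum

namespace IsArcParam

theorem mem (hf : IsArcParam vert S f a b) {s : ℝ} (hs : s ∈ Icc (0 : ℝ) 1) : f s ∈ S :=
  hf.image ▸ mem_image_of_mem f hs

theorem vert_left_mem (hf : IsArcParam vert S f a b) : vert a ∈ S :=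
  hf.zero ▸ hf.mem (left_mem_Icc.2 zero_le_one)

theorem vert_right_mem (hf : IsArcParam vert S f a b) : vert b ∈ S :=
  hf.one ▸ hf.mem (right_mem_Icc.2 zero_le_one)

theorem iccExtend {γ : C(unitInterval, ℂ)} (hγ : Function.Injective γ) (h0 : γ 0 = vert a)
    (h1 : γ 1 = vert b) : IsArcParam vert (range γ) (IccExtend zero_le_one γ) a b where
  continuous := γ.continuous.Icc_extend'
  injOn x hx y hy h := by
    rw [IccExtend_of_mem _ _ hx, IccExtend_of_mem _ _ hy] at h
    exact congrArg Subtype.val (hγ h)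
  image := by
    rw [← IccExtend_range zero_le_one γ]
    refine (image_subset_range _ _).antisymm ?_
    rw [IccExtend_range]
    rintro _ ⟨x, rfl⟩
    exact ⟨x, x.2, IccExtend_of_mem _ _ x.2⟩
  zero := by rw [IccExtend_left]; exact h0
  one := by rw [IccExtend_right]; exact h1

theorem nonvanishingOn_sub (hf : IsArcParam vert S f a b) (hv : vert v ∉ S) :
    NonvanishingOn (fun s => f s - vert v) 0 1 where
  continuousOn := (hf.continuous.sub continuous_const).continuousOn
  ne_zero _ hs h := hv (sub_eq_zero.1 h ▸ hf.mem (uIcc_of_le (zero_le_one' ℝ) ▸ hs))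

theorem exists_hasTurns (hf : IsArcParam vert S f a b) (hv : vert v ∉ S) :
    ∃ ε, HasTurns vert f a b v ε := by
  have hne : ∀ u, vert u ∈ S → vert u - vert v ≠ 0 := fun u hu =>
    sub_ne_zero.2 (ne_of_mem_of_not_mem hu hv)
  refine exists_hasTurnParity_sub ?_
  rw [exp_logChange (hf.nonvanishingOn_sub hv), hf.zero, hf.one, exp_sub,
    exp_log (hne a hf.vert_left_mem), exp_log (hne b hf.vert_right_mem)]

theorem image_rectZeros_sub (hf : IsArcParam vert S f a b) (hg : IsArcParam vert T g c d) :
    (fun p : ℝ × ℝ => f p.1) '' rectZeros (fun s t => f s - g t) 0 1 0 1 = S ∩ T := by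
  ext z
  constructor
  · rintro ⟨⟨s, t⟩, ⟨⟨hs, ht⟩, h⟩, rfl⟩
    have hst : f s = g t := sub_eq_zero.1 h
    exact ⟨hf.mem hs, mem_of_eq_of_mem hst (hg.mem ht)⟩
  · rw [← hf.image, ← hg.image]
    rintro ⟨⟨s, hs, rfl⟩, t, ht, hst⟩
    exact ⟨(s, t), ⟨⟨hs, ht⟩, sub_eq_zero.2 hst.symm⟩, rfl⟩

theorem injOn_fst_rectZeros_sub (hg : IsArcParam vert T g c d) :
    InjOn Prod.fst (rectZeros (fun s t => f s - g t) 0 1 0 1) := by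
  rintro ⟨s, t⟩ ⟨⟨-, ht⟩, h⟩ ⟨_, t'⟩ ⟨⟨-, ht'⟩, h'⟩ rfl
  exact Prod.ext rfl (hg.injOn ht ht' ((sub_eq_zero.1 h).symm.trans (sub_eq_zero.1 h')))

theorem injOn_rectZeros_sub (hf : IsArcParam vert S f a b) (hg : IsArcParam vert T g c d) :
    InjOn (fun p : ℝ × ℝ => f p.1) (rectZeros (fun s t => f s - g t) 0 1 0 1) :=
  hf.injOn.comp hg.injOn_fst_rectZeros_sub fun _ hp => hp.1.1

theorem rectZeros_sub_subset (hf : IsArcParam vert S f a b) (hg : IsArcParam vert T g c d)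
    (ha : vert a ∉ T) (hb : vert b ∉ T) (hc : vert c ∉ S) (hd : vert d ∉ S) :
    rectZeros (fun s t => f s - g t) 0 1 0 1 ⊆ Ioo 0 1 ×ˢ Ioo 0 1 := by
  rintro ⟨s, t⟩ ⟨⟨hs, ht⟩, h⟩
  have hst : f s = g t := sub_eq_zero.1 h
  have hfT : f s ∈ T := hst ▸ hg.mem ht
  have hgS : g t ∈ S := hst ▸ hf.mem hs
  refine ⟨⟨hs.1.lt_of_ne ?_, hs.2.lt_of_ne ?_⟩, ht.1.lt_of_ne ?_, ht.2.lt_of_ne ?_⟩ <;> rintro rfl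
  exacts [ha (hf.zero ▸ hfT), hb (hf.one ▸ hfT), hc (hg.zero ▸ hgS), hd (hg.one ▸ hgS)]

theorem hasTurnParity_rectIndex_sub (hf : IsArcParam vert S f a b) (hg : IsArcParam vert T g c d)
    (ha : vert a ∉ T) (hb : vert b ∉ T) (hc : vert c ∉ S) (hd : vert d ∉ S)
    (hfin : (S ∩ T).Finite) (hX : ∀ p ∈ S ∩ T, IsProperCrossing S T p) :
    HasTurnParity (rectIndex (fun s t => f s - g t) 0 1 0 1) (S ∩ T).ncard := by
  have hinj := hf.injOn_rectZeros_sub hg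
  have hint := hf.rectZeros_sub_subset hg ha hb hc hd
  rw [← hf.image_rectZeros_sub hg, hinj.ncard_image]
  refine hasTurnParity_rectIndex_ncard_rectZeros zero_le_one zero_le_one
    ((hf.continuous.comp continuous_fst).sub (hg.continuous.comp continuous_snd)).continuousOn
    (.of_finite_image (hf.image_rectZeros_sub hg ▸ hfin) hinj) hg.injOn_fst_rectZeros_sub hint
    fun p hp => ?_
  exact hasOddLocalIndex_of_isProperCrossing (Icc_mem_nhds_iff.2 (hint hp).1)
    (Icc_mem_nhds_iff.2 (hint hp).2) hf.continuous.continuousOn hg.continuous.continuousOn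
    hf.injOn hg.injOn (fun _ hs => hf.mem hs) (fun _ ht => hg.mem ht) (sub_eq_zero.1 hp.2)
    (hX _ (hf.image_rectZeros_sub hg ▸ mem_image_of_mem _ hp))

theorem rectIndex_sub (hf : IsArcParam vert S f a b) (hg : IsArcParam vert T g c d)
    (ha : vert a ∉ T) (hb : vert b ∉ T) :
    rectIndex (fun s t => f s - g t) 0 1 0 1 =
      logChange (fun s => f s - vert c) 0 1 + logChange (fun s => g s - vert b) 0 1
        - logChange (fun s => f s - vert d) 0 1 - logChange (fun s => g s - vert a) 0 1 := by
  simp only [rectIndex, hf.zero, hf.one, hg.zero, hg.one]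
  rw [← logChange_neg (hg.nonvanishingOn_sub ha), ← logChange_neg (hg.nonvanishingOn_sub hb)]
  simp only [neg_sub]

theorem ncard_inter_eq (hf : IsArcParam vert S f a b) (hg : IsArcParam vert T g c d)
    (ha : vert a ∉ T) (hb : vert b ∉ T) (hc : vert c ∉ S) (hd : vert d ∉ S)
    (hfin : (S ∩ T).Finite) (hX : ∀ p ∈ S ∩ T, IsProperCrossing S T p)
    (ht : IsFlip vert t) {nc nd ma mb : ZMod 2} (hnc : HasTurns vert f a b c nc)
    (hnd : HasTurns vert f a b d nd) (hma : HasTurns vert g c d a ma)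
    (hmb : HasTurns vert g c d b mb) :
    ((S ∩ T).ncard : ZMod 2) =
      t c a + t c b + t d a + t d b + (nc + nd + ma + mb) := by
  have hne : ∀ {u w}, vert u ∈ T → vert w ∉ T → u ≠ w := fun hu hw h => hw (h ▸ hu)
  have hindex := hf.hasTurnParity_rectIndex_sub hg ha hb hc hd hfin hX
  rw [hf.rectIndex_sub hg ha hb] at hindex
  have hturns := ((hnc.add hmb).sub hnd).sub hma
  have hflips := (((ht c b (hne hg.vert_left_mem hb)).sub (ht c a (hne hg.vert_left_mem ha))).sub
    (ht d b (hne hg.vert_right_mem hb))).add (ht d a (hne hg.vert_right_mem ha))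
  refine hindex.unique ?_
  convert hturns.add hflips using 1 <;> ring

end IsArcParam

namespace Drawing

variable {G : SimpleGraph V} (D : Drawing G) {e e' : G.edgeSet}

theorem exists_isArcParam (e : G.edgeSet) :
    ∃ (f : ℝ → ℂ) (a b : V), (e : Sym2 V) = s(a, b) ∧ IsArcParam D.vert (D.edge e) f a b := by
  obtain ⟨γ, hγ, hr, hends⟩ := D.edge_arc e
  obtain ⟨a, b, hab⟩ : ∃ a b, (e : Sym2 V) = s(a, b) := Sym2.exists.1 ⟨_, rfl⟩
  rw [hab, Sym2.map_mk, Sym2.eq_iff] at hends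
  rw [← hr]
  rcases hends with ⟨h0, h1⟩ | ⟨h0, h1⟩
  · exact ⟨_, a, b, hab, .iccExtend hγ h0 h1⟩
  · exact ⟨_, b, a, hab.trans Sym2.eq_swap, .iccExtend hγ h0 h1⟩

theorem ne_of_independentEdges (hind : IndependentEdges (e : Sym2 V) e') : e ≠ e' := by
  rintro rfl
  induction h : (e : Sym2 V) with
  | _ a b => exact hind a (by simp [h])

theorem vert_notMem_edge (hind : IndependentEdges (e : Sym2 V) e') (h : v ∈ (e : Sym2 V)) :
    D.vert v ∉ D.edge e' :=
  fun hv => hind v ⟨h, D.vert_mem_edge v e' hv⟩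

theorem crossings_eq_inter (hind : IndependentEdges (e : Sym2 V) e') :
    D.crossings e e' = D.edge e ∩ D.edge e' := by
  refine sdiff_eq_left.2 (disjoint_left.2 ?_)
  rintro _ ⟨h, h'⟩ ⟨v, rfl⟩
  exact D.vert_notMem_edge hind (D.vert_mem_edge v e h) h'

theorem isProperCrossing_of_independentEdges (hind : IndependentEdges (e : Sym2 V) e') {p : ℂ}
    (hp : p ∈ D.edge e ∩ D.edge e') : IsProperCrossing (D.edge e) (D.edge e') p :=
  (D.inter_proper e e' (ne_of_independentEdges hind) p hp).resolve_left
    fun ⟨v, h, h', _⟩ => hind v ⟨h, h'⟩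

theorem ncard_crossings_eq_of_hasTurns (ht : IsFlip D.vert t) {f : G.edgeSet → ℝ → ℂ}
    {src tgt : G.edgeSet → V} (hends : ∀ e : G.edgeSet, (e : Sym2 V) = s(src e, tgt e))
    (hparam : ∀ e, IsArcParam D.vert (D.edge e) (f e) (src e) (tgt e)) {y : Sym2 V → V → ZMod 2}
    (hy : ∀ (e : G.edgeSet) (v : V), v ∉ (e : Sym2 V) →
      HasTurns D.vert (f e) (src e) (tgt e) v (y e v))
    (hab : (e : Sym2 V) = s(a, b)) (hcd : (e' : Sym2 V) = s(c, d))
    (hind : IndependentEdges (e : Sym2 V) e') :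
    ((D.crossings e e').ncard : ZMod 2) = t c a + t c b + t d a + t d b +
      (y s(a, b) c + y s(a, b) d + y s(c, d) a + y s(c, d) b) := by
  have hind' : IndependentEdges (e' : Sym2 V) e := fun v h => hind v h.symm
  have hsrc : ∀ e : G.edgeSet, src e ∈ (e : Sym2 V) := fun e => by simp [hends e]
  have htgt : ∀ e : G.edgeSet, tgt e ∈ (e : Sym2 V) := fun e => by simp [hends e]
  have hcard := (hparam e).ncard_inter_eq (hparam e')
    (D.vert_notMem_edge hind (hsrc e)) (D.vert_notMem_edge hind (htgt e))
    (D.vert_notMem_edge hind' (hsrc e')) (D.vert_notMem_edge hind' (htgt e'))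
    (D.inter_finite e e' (ne_of_independentEdges hind))
    (fun p hp => D.isProperCrossing_of_independentEdges hind hp) ht
    (hy e _ fun h => hind _ ⟨h, hsrc e'⟩) (hy e _ fun h => hind _ ⟨h, htgt e'⟩)
    (hy e' _ fun h => hind _ ⟨hsrc e, h⟩) (hy e' _ fun h => hind _ ⟨htgt e, h⟩)
  rw [D.crossings_eq_inter hind, hcard, ← hab, ← hcd]
  obtain ⟨ha, hb⟩ | ⟨ha, hb⟩ := Sym2.eq_iff.1 (hab.symm.trans (hends e)) <;>
    obtain ⟨hc, hd⟩ | ⟨hc, hd⟩ := Sym2.eq_iff.1 (hcd.symm.trans (hends e')) <;>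
    rw [← ha, ← hb, ← hc, ← hd] <;> ring

theorem exists_ncard_crossings_eq :
    ∃ (t : V → V → ZMod 2) (y : Sym2 V → V → ZMod 2), (∀ u v, u ≠ v → t u v + t v u = 1) ∧
      ∀ (e e' : G.edgeSet) (a b c d : V), (e : Sym2 V) = s(a, b) → (e' : Sym2 V) = s(c, d) →
        IndependentEdges (e : Sym2 V) e' →
        ((D.crossings e e').ncard : ZMod 2) = t c a + t c b + t d a + t d b +
          (y s(a, b) c + y s(a, b) d + y s(c, d) a + y s(c, d) b) := by
  obtain ⟨t, ht⟩ := exists_isFlip D.vert_injective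
  choose f src tgt hends hparam using D.exists_isArcParam
  have hturns (e : Sym2 V) (v : V) : ∃ ε, ∀ h : e ∈ G.edgeSet, v ∉ e →
      HasTurns D.vert (f ⟨e, h⟩) (src ⟨e, h⟩) (tgt ⟨e, h⟩) v ε := by
    by_cases h : e ∈ G.edgeSet ∧ v ∉ e
    · obtain ⟨ε, hε⟩ := (hparam ⟨e, h.1⟩).exists_hasTurns fun hv => h.2 (D.vert_mem_edge v _ hv)
      exact ⟨ε, fun _ _ => hε⟩
    · exact ⟨0, fun h1 h2 => absurd ⟨h1, h2⟩ h⟩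
  choose y hy using hturns
  exact ⟨t, y, fun u v => ht.add_eq_one, fun e e' a b c d hab hcd hind =>
    D.ncard_crossings_eq_of_hasTurns ht hends hparam (fun e v hv => hy e v e.2 hv) hab hcd hind⟩

end Drawing

end CrossingParity

/-! ### Combinations of edge-vertex switches -/

section Switches

variable {V : Type*}

/-- The sum of `X` over the fifteen pairs of independent edges of the complete graph with vertices
`a, b, c, d, e`. -/
def sumK5 (X : V → V → V → V → ZMod 2) (a b c d e : V) : ZMod 2 :=
  X a b c d + X a c b d + X a d b c + X a b c e + X a c b e + X a e b c +
  X a b d e + X a d b e + X a e b d + X a c d e + X a d c e + X a e c d +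
  X b c d e + X b d c e + X b e c d

/-- The sum of `X` over the nine pairs of independent edges of the disjoint triangles `abc` and
`def`. -/
def sum2K3 (X : V → V → V → V → ZMod 2) (a b c d e f : V) : ZMod 2 :=
  X a b d e + X a b d f + X a b e f + X a c d e + X a c d f + X a c e f +
  X b c d e + X b c d f + X b c e f

/-- The coordinate at `{ab, cd}` of the combination of the vectors of the edge-vertex switches
`(e, v)` with coefficients `Y e v`. -/
def switchSum (Y : Sym2 V → V → ZMod 2) (a b c d : V) : ZMod 2 :=
  Y s(a, b) c + Y s(a, b) d + Y s(c, d) a + Y s(c, d) b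

/-- The sum of `t` over the four pairs of a vertex of `cd` and a vertex of `ab`. If `t u v`
indicates `u < v` for a linear order of the vertices, this is the crossing parity of `ab` and `cd`
in a convex drawing. -/
def flipSum (t : V → V → ZMod 2) (a b c d : V) : ZMod 2 :=
  t c a + t c b + t d a + t d b

theorem sumK5_add (X Y : V → V → V → V → ZMod 2) (a b c d e : V) :
    sumK5 (fun p q r s => X p q r s + Y p q r s) a b c d e =
      sumK5 X a b c d e + sumK5 Y a b c d e := by
  simp only [sumK5]
  ring

theorem sum2K3_add (X Y : V → V → V → V → ZMod 2) (a b c d e f : V) :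
    sum2K3 (fun p q r s => X p q r s + Y p q r s) a b c d e f =
      sum2K3 X a b c d e f + sum2K3 Y a b c d e f := by
  simp only [sum2K3]
  ring

theorem sumK5_congr {X Y : V → V → V → V → ZMod 2}
    (h : ∀ a b c d, [a, b, c, d].Nodup → X a b c d = Y a b c d) {a b c d e : V}
    (hd : [a, b, c, d, e].Nodup) : sumK5 X a b c d e = sumK5 Y a b c d e := by
  simp only [List.nodup_cons, List.mem_cons, List.not_mem_nil, not_or, or_false] at hd
  simp [sumK5, h, hd, Ne.symm]

theorem sum2K3_congr {X Y : V → V → V → V → ZMod 2}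
    (h : ∀ a b c d, [a, b, c, d].Nodup → X a b c d = Y a b c d) {a b c d e f : V}
    (hd : [a, b, c, d, e, f].Nodup) : sum2K3 X a b c d e f = sum2K3 Y a b c d e f := by
  simp only [List.nodup_cons, List.mem_cons, List.not_mem_nil, not_or, or_false] at hd
  simp [sum2K3, h, hd]

theorem switchSum_add (Y Y' : Sym2 V → V → ZMod 2) (a b c d : V) :
    switchSum (Y + Y') a b c d = switchSum Y a b c d + switchSum Y' a b c d := by
  simp only [switchSum, Pi.add_apply]
  ring

theorem sumK5_switchSum (Y : Sym2 V → V → ZMod 2) (a b c d e : V) :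
    sumK5 (switchSum Y) a b c d e = 0 := by
  simp only [sumK5, switchSum]
  ring_nf
  reduce_mod_char

theorem sum2K3_switchSum (Y : Sym2 V → V → ZMod 2) (a b c d e f : V) :
    sum2K3 (switchSum Y) a b c d e f = 0 := by
  simp only [sum2K3, switchSum]
  ring_nf
  reduce_mod_char

theorem sum2K3_flipSum (t : V → V → ZMod 2) (a b c d e f : V) :
    sum2K3 (flipSum t) a b c d e f = 0 := by
  simp only [sum2K3, flipSum]
  ring_nf
  reduce_mod_char

theorem sumK5_flipSum {t : V → V → ZMod 2} {k : ZMod 2} (ht : ∀ u v, u ≠ v → t u v + t v u = k)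
    {a b c d e : V} (hd : [a, b, c, d, e].Nodup) : sumK5 (flipSum t) a b c d e = k := by
  have hsum : sumK5 (flipSum t) a b c d e =
      (t c d + t d c) + (t c e + t e c) + (t d e + t e d) := by
    simp only [sumK5, flipSum]
    ring_nf
    reduce_mod_char
  rw [hsum, ht c d (by grind), ht c e (by grind), ht d e (by grind), CharTwo.add_self_eq_zero,
    zero_add]

/-- At distinct vertices `a, b, c, d`, the value of `X` depends only on the unordered pair of
`s(a, b)` and `s(c, d)`. The first two laws hold at all vertices, so that `X` descends to functions
of an edge and a vertex. -/
structure IsPairSymm (X : V → V → V → V → ZMod 2) : Prop where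
  swap_left : ∀ a b c d, X b a c d = X a b c d
  swap_right : ∀ a b c d, X a b d c = X a b c d
  comm : ∀ {a b c d}, [a, b, c, d].Nodup → X c d a b = X a b c d

namespace IsPairSymm

variable {X X' : V → V → V → V → ZMod 2}

theorem add (h : IsPairSymm X) (h' : IsPairSymm X') :
    IsPairSymm fun a b c d => X a b c d + X' a b c d where
  swap_left a b c d := by rw [h.swap_left, h'.swap_left]
  swap_right a b c d := by rw [h.swap_right, h'.swap_right]
  comm hd := by rw [h.comm hd, h'.comm hd]

theorem eq_of_nodup (h : IsPairSymm X) (h' : IsPairSymm X') {o a b c d : V}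
    (hmem : ∀ b c d, [o, b, c, d].Nodup → X o b c d = X' o b c d)
    (hnotMem : [o, a, b, c, d].Nodup → X a b c d = X' a b c d) (hd : [a, b, c, d].Nodup) :
    X a b c d = X' a b c d := by
  obtain rfl | ha := eq_or_ne o a
  · exact hmem b c d hd
  obtain rfl | hb := eq_or_ne o b
  · rw [← h.swap_left, ← h'.swap_left]
    exact hmem a c d (by grind)
  obtain rfl | hc := eq_or_ne o c
  · rw [← h.comm hd, ← h'.comm hd]
    exact hmem d a b (by grind)
  obtain rfl | hd' := eq_or_ne o d
  · rw [← h.comm hd, ← h'.comm hd, ← h.swap_left, ← h'.swap_left]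
    exact hmem c a b (by grind)
  exact hnotMem (by grind)

end IsPairSymm

theorem isPairSymm_switchSum (Y : Sym2 V → V → ZMod 2) : IsPairSymm (switchSum Y) where
  swap_left a b c d := by simp only [switchSum, Sym2.eq_swap (a := b) (b := a)]; ring
  swap_right a b c d := by simp only [switchSum, Sym2.eq_swap (a := d) (b := c)]; ring
  comm _ := by simp only [switchSum]; ring

theorem isPairSymm_flipSum {t : V → V → ZMod 2} {k : ZMod 2}
    (ht : ∀ u v, u ≠ v → t u v + t v u = k) :
    IsPairSymm (flipSum t) where
  swap_left a b c d := by simp only [flipSum]; ring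
  swap_right a b c d := by simp only [flipSum]; ring
  comm {a b c d} hd := by
    have hac := ht a c (by grind)
    have had := ht a d (by grind)
    have hbc := ht b c (by grind)
    have hbd := ht b d (by grind)
    simp only [flipSum]
    grind

theorem exists_add_eq_of_cocycle {s : Set V} {h : V → V → ZMod 2} (hsymm : ∀ a b, h a b = h b a)
    (hcocycle : ∀ a ∈ s, ∀ b ∈ s, ∀ c ∈ s, a ≠ b → a ≠ c → b ≠ c → h a b + h a c + h b c = 0) :
    ∃ f : V → ZMod 2, ∀ a ∈ s, ∀ b ∈ s, a ≠ b → h a b = f a + f b := by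
  classical
  obtain rfl | ⟨q, hq⟩ := s.eq_empty_or_nonempty
  · exact ⟨0, by simp⟩
  refine ⟨fun a => if a = q then 0 else h q a, fun a ha b hb hab => ?_⟩
  obtain rfl | hqa := eq_or_ne a q
  · simp [hab.symm]
  obtain rfl | hqb := eq_or_ne b q
  · simp [hqa, hsymm a]
  simp only [hqa, hqb, if_false]
  grind

theorem eq_flipSum_of_isPairSymm {Z : V → V → V → V → ZMod 2} (hZ : IsPairSymm Z)
    {S : V → V → ZMod 2} (hS : ∀ a b, S a b = S b a) {p : V}
    (h5 : ∀ a b c d e, [a, b, c, d, e].Nodup → Z a b c d + Z a b c e + Z a b d e = 0)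
    (hp : ∀ b c d, [p, b, c, d].Nodup → Z p b c d = flipSum S p b c d)
    {a b c d : V} (hd : [a, b, c, d].Nodup) : Z a b c d = flipSum S a b c d := by
  refine hZ.eq_of_nodup (isPairSymm_flipSum fun u v _ => CharTwo.add_eq_zero.2 (hS u v)) hp
    (fun h => ?_) hd
  have hacd : [p, a, c, d].Nodup := by clear h5 hp; grind
  have hbcd : [p, b, c, d].Nodup := by clear h5 hp; grind
  have h' := h5 c d p a b (by clear h5 hp; grind)
  rw [hZ.comm hacd, hZ.comm hbcd, hZ.comm hd, hp a c d hacd, hp b c d hbcd] at h'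
  rw [← CharTwo.add_eq_zero, ← h']
  simp only [flipSum]
  linear_combination -CharTwo.add_self_eq_zero (S c p) - CharTwo.add_self_eq_zero (S d p)

theorem exists_flipSum_eq {Z : V → V → V → V → ZMod 2} (hZ : IsPairSymm Z)
    (h4 : ∀ a b c d, [a, b, c, d].Nodup → Z a b c d + Z a c b d + Z a d b c = 0)
    (h5 : ∀ a b c d e, [a, b, c, d, e].Nodup → Z a b c d + Z a b c e + Z a b d e = 0) :
    ∃ S : V → V → ZMod 2, (∀ a b, S a b = S b a) ∧
      ∀ a b c d, [a, b, c, d].Nodup → Z a b c d = flipSum S a b c d := by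
  classical
  obtain hV | ⟨⟨p⟩⟩ := isEmpty_or_nonempty V
  · exact ⟨0, by simp, fun a => hV.elim a⟩
  have hcut : ∀ b, ∃ f : V → ZMod 2, ∀ c d, [p, b, c, d].Nodup → Z p b c d = f c + f d := by
    intro b
    obtain ⟨f, hf⟩ := exists_add_eq_of_cocycle (s := {v | [p, b, v].Nodup})
      (fun c d => hZ.swap_right p b d c) fun c hc d hd e he hcd hce hde =>
        h5 p b c d e (by simp_all)
    exact ⟨f, fun c d h => hf c (by simp_all) d (by simp_all) (by simp_all)⟩
  choose T hT using hcut
  obtain ⟨n, hn⟩ := exists_add_eq_of_cocycle (s := {v | v ≠ p}) (h := fun b c => T b c + T c b)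
    (fun b c => add_comm _ _) fun b (hb : b ≠ p) c (hc : c ≠ p) d (hd : d ≠ p) hbc hbd hcd => by
      have h := h4 p b c d (by simp [*, Ne.symm])
      rw [hT b c d (by simp [*, Ne.symm]), hT c b d (by simp [*, Ne.symm]),
        hT d b c (by simp [*, Ne.symm])] at h
      rw [← h]
      ring
  let S : V → V → ZMod 2 := fun b c => if b = p ∨ c = p then 0 else T b c + n b
  have hS : ∀ b c, S b c = S c b := by
    intro b c
    obtain rfl | hbc := eq_or_ne b c
    · rfl
    by_cases h : b = p ∨ c = p
    · simp only [S, if_pos h, if_pos h.symm]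
    · simp only [S, if_neg h, if_neg (mt Or.symm h)]
      obtain ⟨hb, hc⟩ := not_or.1 h
      rw [← CharTwo.add_eq_zero]
      linear_combination hn b hb c hc hbc + CharTwo.add_self_eq_zero (n b) +
        CharTwo.add_self_eq_zero (n c)
  have hp : ∀ b c d, [p, b, c, d].Nodup → Z p b c d = S b c + S b d := by
    intro b c d h
    rw [hT b c d h]
    have : b ≠ p ∧ c ≠ p ∧ d ≠ p := by simp_all [eq_comm]
    simp only [S, this, or_self, if_false]
    linear_combination - CharTwo.add_self_eq_zero (n b)
  refine ⟨S, hS, fun a b c d hd =>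
    eq_flipSum_of_isPairSymm hZ hS (p := p) h5 (fun b c d h => ?_) hd⟩
  simp [flipSum, hp b c d h, S, hS c b, hS d b]

theorem exists_switchSum_eq_flipSum {S : V → V → ZMod 2} (hS : ∀ a b, S a b = S b a) :
    ∃ Y : Sym2 V → V → ZMod 2, ∀ a b c d, [a, b, c, d].Nodup →
      switchSum Y a b c d = flipSum S a b c d := by
  obtain ⟨_, -⟩ := exists_wellFoundedLT V
  let z : V → V → ZMod 2 := fun a b => if a < b then S a b else 0
  have hz : ∀ a b, a ≠ b → z a b + z b a = S a b := fun a b hab => by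
    obtain h | h := hab.lt_or_gt <;> simp [z, h, h.not_gt, hS b a]
  refine ⟨fun e v => Sym2.lift ⟨fun b c => z v b + z v c, fun b c => add_comm _ _⟩ e,
    fun a b c d hd => ?_⟩
  simp only [switchSum, flipSum, Sym2.lift_mk]
  rw [← hz c a, ← hz c b, ← hz d a, ← hz d b]
  · ring
  all_goals grind

theorem exists_switchSum_eq_of_star (o : V) (S : V → V → ZMod 2) :
    ∃ Y : Sym2 V → V → ZMod 2,
      (∀ a b c, [o, a, b, c].Nodup → switchSum Y o a b c = S a b + S a c) ∧
      ∀ a b c d, [o, a, b, c, d].Nodup → switchSum Y a b c d = 0 := by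
  classical
  refine ⟨fun e v => Sym2.lift ⟨fun b c => (if b = o then S c v else 0) +
    (if c = o then S b v else 0), fun b c => add_comm _ _⟩ e, fun a b c hd => ?_,
    fun a b c d hd => ?_⟩ <;>
  · simp only [switchSum, Sym2.lift_mk]
    grind

theorem exists_add_switchSum_eq_zero {X : V → V → V → V → ZMod 2} (hX : IsPairSymm X) (o : V) :
    ∃ Y : Sym2 V → V → ZMod 2, ∀ a b c, [o, a, b, c].Nodup →
      X o a b c + switchSum Y o a b c = 0 := by
  classical
  refine ⟨fun e v => Sym2.lift ⟨fun b c => if v = o ∨ b = o ∨ c = o then 0 else X o v b c,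
    fun b c => by simp only [or_comm (a := b = o), hX.swap_right o v c b]⟩ e, fun a b c hd => ?_⟩
  simp only [switchSum, Sym2.lift_mk]
  grind

theorem sumK5_of_vanishing {Z : V → V → V → V → ZMod 2} {o a b c d : V}
    (ho : ∀ a b c, [o, a, b, c].Nodup → Z o a b c = 0) (hd : [o, a, b, c, d].Nodup) :
    sumK5 Z o a b c d = Z a b c d + Z a c b d + Z a d b c := by
  simp only [List.nodup_cons, List.mem_cons, List.not_mem_nil, not_or, or_false] at hd
  simp [sumK5, ho, hd, Ne.symm]

theorem sum2K3_of_vanishing {Z : V → V → V → V → ZMod 2} {o a b c d e : V}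
    (ho : ∀ a b c, [o, a, b, c].Nodup → Z o a b c = 0) (hd : [o, a, b, c, d, e].Nodup) :
    sum2K3 Z o a b c d e = Z a b c d + Z a b c e + Z a b d e := by
  simp only [List.nodup_cons, List.mem_cons, List.not_mem_nil, not_or, or_false] at hd
  simp [sum2K3, ho, hd]

theorem exists_switchSum_eq_of_vanishing {Z : V → V → V → V → ZMod 2} (hZ : IsPairSymm Z)
    (hK5 : ∀ a b c d e, [a, b, c, d, e].Nodup → sumK5 Z a b c d e = 0)
    (h2K3 : ∀ a b c d e f, [a, b, c, d, e, f].Nodup → sum2K3 Z a b c d e f = 0) {o : V}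
    (ho : ∀ a b c, [o, a, b, c].Nodup → Z o a b c = 0) :
    ∃ Y : Sym2 V → V → ZMod 2, ∀ a b c d, [a, b, c, d].Nodup → Z a b c d = switchSum Y a b c d := by
  classical
  have hcons : ∀ l : List {v // v ≠ o}, l.Nodup → (o :: l.map Subtype.val).Nodup := fun l hl =>
    List.nodup_cons.2 ⟨by simp, hl.map Subtype.val_injective⟩
  obtain ⟨S, hS, hZS⟩ := exists_flipSum_eq (V := {v // v ≠ o}) (Z := fun a b c d => Z a b c d)
    ⟨fun _ _ _ _ => hZ.swap_left _ _ _ _, fun _ _ _ _ => hZ.swap_right _ _ _ _,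
      fun hd => hZ.comm (hd.map Subtype.val_injective)⟩
    (fun _ _ _ _ hd => (sumK5_of_vanishing ho (hcons _ hd)).symm.trans (hK5 _ _ _ _ _ (hcons _ hd)))
    (fun _ _ _ _ _ hd =>
      (sum2K3_of_vanishing ho (hcons _ hd)).symm.trans (h2K3 _ _ _ _ _ _ (hcons _ hd)))
  let S' : V → V → ZMod 2 := fun a b => if h : a ≠ o ∧ b ≠ o then S ⟨a, h.1⟩ ⟨b, h.2⟩ else 0
  have hS' : ∀ a b, S' a b = S' b a := fun a b => by
    simp only [S', and_comm (a := a ≠ o)]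
    split_ifs
    exacts [hS _ _, rfl]
  have hZS' : ∀ a b c d, [o, a, b, c, d].Nodup → Z a b c d = flipSum S' a b c d := by
    intro a b c d hd
    obtain ⟨ha, hb, hc, hd'⟩ : a ≠ o ∧ b ≠ o ∧ c ≠ o ∧ d ≠ o := by simp_all [eq_comm]
    rw [hZS ⟨a, ha⟩ ⟨b, hb⟩ ⟨c, hc⟩ ⟨d, hd'⟩ (.of_map Subtype.val hd.of_cons)]
    simp [flipSum, S', ha, hb, hc, hd']
  obtain ⟨Y₁, hY₁⟩ := exists_switchSum_eq_flipSum hS'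
  obtain ⟨Y₂, hY₂, hY₂'⟩ := exists_switchSum_eq_of_star o S'
  refine ⟨Y₁ + Y₂, fun a b c d hd => hZ.eq_of_nodup (isPairSymm_switchSum _) (o := o)
    (fun b c d h => ?_) (fun h => ?_) hd⟩
  · rw [ho b c d h, switchSum_add, hY₁ o b c d h, hY₂ b c d h]
    have hS'o : ∀ a, S' a o = 0 := fun a => dif_neg fun h => h.2 rfl
    simp only [flipSum, hS'o, hS' c b, hS' d b]
    linear_combination -CharTwo.add_self_eq_zero (S' b c) - CharTwo.add_self_eq_zero (S' b d)
  · rw [switchSum_add, hY₁ a b c d hd, hY₂' a b c d h, hZS' a b c d h, add_zero]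

theorem exists_switchSum_eq {X : V → V → V → V → ZMod 2} (hX : IsPairSymm X)
    (hK5 : ∀ a b c d e, [a, b, c, d, e].Nodup → sumK5 X a b c d e = 0)
    (h2K3 : ∀ a b c d e f, [a, b, c, d, e, f].Nodup → sum2K3 X a b c d e f = 0) :
    ∃ Y : Sym2 V → V → ZMod 2, ∀ a b c d, [a, b, c, d].Nodup → X a b c d = switchSum Y a b c d := by
  obtain hV | ⟨⟨o⟩⟩ := isEmpty_or_nonempty V
  · exact ⟨0, fun a => hV.elim a⟩
  obtain ⟨Y₁, hY₁⟩ := exists_add_switchSum_eq_zero hX o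
  obtain ⟨Y₂, hY₂⟩ := exists_switchSum_eq_of_vanishing (hX.add (isPairSymm_switchSum Y₁))
    (fun a b c d e hd => by rw [sumK5_add, hK5 a b c d e hd, sumK5_switchSum, add_zero])
    (fun a b c d e f hd => by rw [sum2K3_add, h2K3 a b c d e f hd, sum2K3_switchSum, add_zero]) hY₁
  refine ⟨Y₁ + Y₂, fun a b c d hd => ?_⟩
  rw [switchSum_add, ← hY₂ a b c d hd]
  linear_combination -CharTwo.add_self_eq_zero (switchSum Y₁ a b c d)

end Switches

/-! ### AT-subgraphs and crossing parities -/

section IndepPairs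

variable {V W : Type*} {G : SimpleGraph V} {a b c d : V}

theorem independentEdges_mk_iff :
    IndependentEdges s(a, b) s(c, d) ↔ a ≠ c ∧ a ≠ d ∧ b ≠ c ∧ b ≠ d := by
  constructor
  · intro h
    exact ⟨by rintro rfl; exact h a (by simp), by rintro rfl; exact h a (by simp),
      by rintro rfl; exact h b (by simp), by rintro rfl; exact h b (by simp)⟩
  · intro h v
    simp only [Sym2.mem_iff]
    grind

theorem independentEdges_comm {e f : Sym2 V} : IndependentEdges e f ↔ IndependentEdges f e :=
  forall_congr' fun _ => not_congr and_comm

theorem mk_mem_indepPairs_iff {e f : Sym2 V} :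
    s(e, f) ∈ indepPairs G ↔ e ∈ G.edgeSet ∧ f ∈ G.edgeSet ∧ IndependentEdges e f := by
  refine ⟨fun ⟨e', f', he, hf, h, heq⟩ => ?_, fun ⟨he, hf, h⟩ => ⟨e, f, he, hf, h, rfl⟩⟩
  obtain ⟨rfl, rfl⟩ | ⟨rfl, rfl⟩ := Sym2.eq_iff.1 heq
  exacts [⟨he, hf, h⟩, ⟨hf, he, independentEdges_comm.1 h⟩]

theorem mem_indepPairs_iff :
    s(s(a, b), s(c, d)) ∈ indepPairs G ↔
      G.Adj a b ∧ G.Adj c d ∧ a ≠ c ∧ a ≠ d ∧ b ≠ c ∧ b ≠ d := by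
  rw [mk_mem_indepPairs_iff, independentEdges_mk_iff, SimpleGraph.mem_edgeSet,
    SimpleGraph.mem_edgeSet]

theorem mem_indepPairs_top_iff :
    s(s(a, b), s(c, d)) ∈ indepPairs (⊤ : SimpleGraph V) ↔ [a, b, c, d].Nodup := by
  rw [mem_indepPairs_iff]
  simp only [SimpleGraph.top_adj]
  grind

theorem map_mem_indepPairs {K : SimpleGraph W} (j : SimpleGraph.Copy K G)
    {p : Sym2 (Sym2 W)} (hp : p ∈ indepPairs K) : p.map (Sym2.map j) ∈ indepPairs G := by
  induction p with | _ e f =>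
  induction e with | _ a b =>
  induction f with | _ c d =>
  obtain ⟨hab, hcd, hac, had, hbc, hbd⟩ := mem_indepPairs_iff.1 hp
  exact mem_indepPairs_iff.2 ⟨j.toHom.map_adj hab, j.toHom.map_adj hcd, j.injective.ne hac,
    j.injective.ne had, j.injective.ne hbc, j.injective.ne hbd⟩

end IndepPairs

namespace ATGraph

section Copies

variable {V W : Type*} {K : SimpleGraph W}

/-- The pairs of independent edges of `K` that `j` sends to pairs of `A`. They count the pairs of
the AT-subgraph of `A` that is the image of a copy `j` of `K`. -/
def copyPairs (A : ATGraph V) (K : SimpleGraph W) (j : W → V) : Set (Sym2 (Sym2 W)) :=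
  {p | p ∈ indepPairs K ∧ p.map (Sym2.map j) ∈ A.pairs}

theorem ncard_pairs_of_iso (B : ATGraph V) (ι : B.graph ≃g K) :
    B.pairs.ncard = (B.copyPairs K ι.symm).ncard := by
  have hinj : Function.Injective (Sym2.map (Sym2.map ι.symm)) :=
    Sym2.map.injective (Sym2.map.injective ι.symm.injective)
  rw [← Set.ncard_image_of_injective _ hinj]
  congr 1
  refine Set.Subset.antisymm (fun p hp => ?_) (Set.image_subset_iff.2 fun q hq => hq.2)
  have hmap : (p.map (Sym2.map ι)).map (Sym2.map ι.symm) = p := by simp [Sym2.map_map]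
  exact ⟨p.map (Sym2.map ι), ⟨map_mem_indepPairs ι.toCopy (B.pairs_subset hp), hmap.symm ▸ hp⟩,
    hmap⟩

theorem ncard_sub_pairs (A : ATGraph V) (H : A.graph.Subgraph) (ι : H.coe ≃g K) :
    (A.sub H).pairs.ncard = (A.copyPairs K fun w => (ι.symm w : V)).ncard := by
  rw [ncard_pairs_of_iso (A.sub H) ι]
  congr 1
  ext p
  refine and_congr_right fun hp => ?_
  have hmap : (p.map (Sym2.map ι.symm)).map (Sym2.map Subtype.val) =
      p.map (Sym2.map fun w => (ι.symm w : V)) := by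
    simp only [Sym2.map_map, Function.comp_def]
  rw [← hmap]
  exact ⟨fun h => h.2, fun h => ⟨map_mem_indepPairs ι.symm.toCopy hp, h⟩⟩

theorem exists_sub_iff (A : ATGraph V) (P : ℕ → Prop) :
    (∃ H : A.graph.Subgraph, Nonempty (H.coe ≃g K) ∧ P (A.sub H).pairs.ncard) ↔
      ∃ j : SimpleGraph.Copy K A.graph, P (A.copyPairs K j).ncard := by
  constructor
  · rintro ⟨H, ⟨ι⟩, h⟩
    rw [ncard_sub_pairs A H ι] at h
    exact ⟨H.coeCopy.comp ι.symm.toCopy, h⟩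
  · rintro ⟨j, h⟩
    refine ⟨j.toSubgraph, ⟨j.isoToSubgraph.symm⟩, ?_⟩
    rwa [ncard_sub_pairs A j.toSubgraph j.isoToSubgraph.symm]

theorem not_containsOdd_iff (A : ATGraph V) :
    ¬ A.ContainsOdd K ↔
      ∀ j : SimpleGraph.Copy K A.graph, ((A.copyPairs K j).ncard : ZMod 2) = 0 := by
  rw [ContainsOdd, A.exists_sub_iff Odd, not_exists]
  simp only [ZMod.natCast_eq_zero_iff_even, Nat.not_odd_iff_even]

theorem not_containsEven_iff (A : ATGraph V) :
    ¬ A.ContainsEven K ↔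
      ∀ j : SimpleGraph.Copy K A.graph, ((A.copyPairs K j).ncard : ZMod 2) = 1 := by
  rw [ContainsEven, A.exists_sub_iff Even, not_exists]
  simp only [ZMod.natCast_eq_one_iff_odd, Nat.not_even_iff_odd]

end Copies

section PairVal

variable {V W : Type*}

open Classical in
/-- The characteristic function of the pairs of `A`: its value at `a, b, c, d` is `1` if
`{ab, cd}` is a pair of `A`, and `0` otherwise. -/
noncomputable def pairVal (A : ATGraph V) (a b c d : V) : ZMod 2 :=
  if s(s(a, b), s(c, d)) ∈ A.pairs then 1 else 0

theorem isPairSymm_pairVal (A : ATGraph V) : IsPairSymm A.pairVal where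
  swap_left a b c d := by rw [pairVal, pairVal, Sym2.eq_swap (a := a)]
  swap_right a b c d := by rw [pairVal, pairVal, Sym2.eq_swap (a := c)]
  comm {a b c d} _ := by rw [pairVal, pairVal, Sym2.eq_swap (a := s(a, b))]

theorem ncard_copyPairs {K : SimpleGraph W} (A : ATGraph V) (j : W → V)
    (L : List (W × W × W × W)) (hnd : (L.map fun q => s(s(q.1, q.2.1), s(q.2.2.1, q.2.2.2))).Nodup)
    (hL : ∀ a b c d, s(s(a, b), s(c, d)) ∈ L.map (fun q => s(s(q.1, q.2.1), s(q.2.2.1, q.2.2.2))) ↔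
      K.Adj a b ∧ K.Adj c d ∧ a ≠ c ∧ a ≠ d ∧ b ≠ c ∧ b ≠ d) :
    ((A.copyPairs K j).ncard : ZMod 2) =
      (L.map fun q => A.pairVal (j q.1) (j q.2.1) (j q.2.2.1) (j q.2.2.2)).sum := by
  classical
  set M := L.map fun q => s(s(q.1, q.2.1), s(q.2.2.1, q.2.2.2)) with hM
  have hset : A.copyPairs K j = ↑(M.toFinset.filter fun p => p.map (Sym2.map j) ∈ A.pairs) := by
    ext p
    induction p with | _ e f =>
    induction e with | _ a b =>
    induction f with | _ c d =>
    simp only [copyPairs, Set.mem_ofPred_eq, mem_indepPairs_iff, Finset.coe_filter,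
      List.mem_toFinset, hL]
  rw [hset, Set.ncard_coe_finset, Finset.card_filter]
  push_cast
  rw [List.sum_toFinset _ hnd, hM, List.map_map]
  rfl

theorem ncard_copyPairs_K5 (A : ATGraph V) (j : Fin 5 → V) :
    ((A.copyPairs graphK5 j).ncard : ZMod 2) = sumK5 A.pairVal (j 0) (j 1) (j 2) (j 3) (j 4) := by
  rw [A.ncard_copyPairs j
    [(0, 1, 2, 3), (0, 2, 1, 3), (0, 3, 1, 2), (0, 1, 2, 4), (0, 2, 1, 4), (0, 4, 1, 2),
      (0, 1, 3, 4), (0, 3, 1, 4), (0, 4, 1, 3), (0, 2, 3, 4), (0, 3, 2, 4), (0, 4, 2, 3),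
      (1, 2, 3, 4), (1, 3, 2, 4), (1, 4, 2, 3)] (by decide) (by decide)]
  simp only [List.map_cons, List.map_nil, List.sum_cons, List.sum_nil, sumK5]
  ring

theorem ncard_copyPairs_2K3 (A : ATGraph V) (j : Fin 3 ⊕ Fin 3 → V) :
    ((A.copyPairs graph2K3 j).ncard : ZMod 2) =
      sum2K3 A.pairVal (j (.inl 0)) (j (.inl 1)) (j (.inl 2)) (j (.inr 0)) (j (.inr 1))
        (j (.inr 2)) := by
  rw [A.ncard_copyPairs j
    [(.inl 0, .inl 1, .inr 0, .inr 1), (.inl 0, .inl 1, .inr 0, .inr 2),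
      (.inl 0, .inl 1, .inr 1, .inr 2), (.inl 0, .inl 2, .inr 0, .inr 1),
      (.inl 0, .inl 2, .inr 0, .inr 2), (.inl 0, .inl 2, .inr 1, .inr 2),
      (.inl 1, .inl 2, .inr 0, .inr 1), (.inl 1, .inl 2, .inr 0, .inr 2),
      (.inl 1, .inl 2, .inr 1, .inr 2)] (by decide) (by
        let _ : DecidableRel graph2K3.Adj := fun a b => match a, b with
          | .inl a, .inl b => inferInstanceAs (Decidable (a ≠ b))
          | .inr a, .inr b => inferInstanceAs (Decidable (a ≠ b))
          | .inl _, .inr _ => .isFalse (by simp)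
          | .inr _, .inl _ => .isFalse (by simp)
        decide)]
  simp only [List.map_cons, List.map_nil, List.sum_cons, List.sum_nil, sum2K3]
  ring

end PairVal

section Complete

variable {V : Type*} {A : ATGraph V}

theorem IsComplete.forall_copy_K5_iff (hA : A.IsComplete) {k : ZMod 2} :
    (∀ j : SimpleGraph.Copy graphK5 A.graph, ((A.copyPairs graphK5 j).ncard : ZMod 2) = k) ↔
      ∀ a b c d e, [a, b, c, d, e].Nodup → sumK5 A.pairVal a b c d e = k := by
  refine ⟨fun h a b c d e hd => ?_, fun h j => ?_⟩
  · have hinj : Function.Injective ![a, b, c, d, e] := List.nodup_ofFn.1 (by simpa using hd)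
    have := h ⟨⟨![a, b, c, d, e], fun {u v} huv => by rw [hA]; exact hinj.ne huv⟩, hinj⟩
    rwa [ncard_copyPairs_K5] at this
  · rw [ncard_copyPairs_K5]
    exact h _ _ _ _ _ (List.nodup_ofFn.2 j.injective)

theorem IsComplete.forall_copy_2K3_iff (hA : A.IsComplete) {k : ZMod 2} :
    (∀ j : SimpleGraph.Copy graph2K3 A.graph, ((A.copyPairs graph2K3 j).ncard : ZMod 2) = k) ↔
      ∀ a b c d e f, [a, b, c, d, e, f].Nodup → sum2K3 A.pairVal a b c d e f = k := by
  refine ⟨fun h a b c d e f hd => ?_, fun h j => ?_⟩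
  · have hinj : Function.Injective (Sum.elim ![a, b, c] ![d, e, f]) := by
      obtain ⟨hd₁, hd₂, hdisj⟩ := (List.nodup_append (l₁ := [a, b, c]) (l₂ := [d, e, f])).1 hd
      refine .sumElim (List.nodup_ofFn.1 (by simpa using hd₁))
        (List.nodup_ofFn.1 (by simpa using hd₂)) fun i k => ?_
      fin_cases i <;> fin_cases k <;> exact hdisj _ (by simp) _ (by simp)
    have := h ⟨⟨Sum.elim ![a, b, c] ![d, e, f], fun {u v} huv => by
      rw [hA]; exact hinj.ne huv.ne⟩, hinj⟩
    rwa [ncard_copyPairs_2K3] at this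
  · rw [ncard_copyPairs_2K3]
    have hd : ([.inl 0, .inl 1, .inl 2, .inr 0, .inr 1, .inr 2] : List (Fin 3 ⊕ Fin 3)).Nodup := by
      decide
    exact h _ _ _ _ _ _ (hd.map j.injective)

theorem IsComplete.not_containsEven_K5_iff (hA : A.IsComplete) :
    ¬ A.ContainsEven graphK5 ↔
      ∀ a b c d e, [a, b, c, d, e].Nodup → sumK5 A.pairVal a b c d e = 1 := by
  rw [A.not_containsEven_iff, hA.forall_copy_K5_iff]

theorem IsComplete.not_containsOdd_K5_iff (hA : A.IsComplete) :
    ¬ A.ContainsOdd graphK5 ↔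
      ∀ a b c d e, [a, b, c, d, e].Nodup → sumK5 A.pairVal a b c d e = 0 := by
  rw [A.not_containsOdd_iff, hA.forall_copy_K5_iff]

theorem IsComplete.not_containsOdd_2K3_iff (hA : A.IsComplete) :
    ¬ A.ContainsOdd graph2K3 ↔
      ∀ a b c d e f, [a, b, c, d, e, f].Nodup → sum2K3 A.pairVal a b c d e f = 0 := by
  rw [A.not_containsOdd_iff, hA.forall_copy_2K3_iff]

theorem IsComplete.sub_induce (hA : A.IsComplete) (s : Set V) :
    (A.sub ((⊤ : A.graph.Subgraph).induce s)).IsComplete := by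
  ext u v
  have huv : (u : V) ∈ s ∧ (v : V) ∈ s := ⟨u.2, v.2⟩
  simp [sub, show A.graph = ⊤ from hA, Subtype.ext_iff, huv]

theorem IsComplete.pairVal_sub_induce (hA : A.IsComplete) {s : Set V} {a b c d : s}
    (hd : [a, b, c, d].Nodup) :
    (A.sub ((⊤ : A.graph.Subgraph).induce s)).pairVal a b c d = A.pairVal a b c d := by
  have hmem : s(s(a, b), s(c, d)) ∈ indepPairs (A.sub ((⊤ : A.graph.Subgraph).induce s)).graph := by
    rw [hA.sub_induce s]
    exact mem_indepPairs_top_iff.2 hd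
  classical
  exact if_congr (and_iff_right hmem) rfl rfl

end Complete

end ATGraph

section Parity

variable {V : Type*}

/-- The crossing parities of the pairs of independent edges of `D` are the values of `X`. -/
def Drawing.HasCrossingParities {G : SimpleGraph V} (D : Drawing G)
    (X : V → V → V → V → ZMod 2) : Prop :=
  ∀ a b c d (hab : G.Adj a b) (hcd : G.Adj c d), IndependentEdges s(a, b) s(c, d) →
    ((D.crossings ⟨s(a, b), hab⟩ ⟨s(c, d), hcd⟩).ncard : ZMod 2) = X a b c d

namespace ATGraph

variable {A : ATGraph V}

theorem isIndepZ2Realization_iff {D : Drawing A.graph} :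
    A.IsIndepZ2Realization D ↔ D.HasCrossingParities A.pairVal := by
  classical
  have key (n : ℕ) (p : Prop) [Decidable p] : (p ↔ Odd n) ↔
      (n : ZMod 2) = if p then 1 else 0 := by
    split_ifs with hp
    · rw [ZMod.natCast_eq_one_iff_odd, iff_true_left hp]
    · rw [ZMod.natCast_eq_zero_iff_even, iff_false_left hp, Nat.not_odd_iff_even]
  refine ⟨fun h a b c d hab hcd hind => (key _ _).1 (h ⟨_, hab⟩ ⟨_, hcd⟩ hind), ?_⟩
  rintro h ⟨e, he⟩ ⟨f, hf⟩ hind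
  induction e with | _ a b =>
  induction f with | _ c d =>
  exact (key _ _).2 (h a b c d he hf hind)

theorem IsComplete.exists_pairVal_eq (hA : A.IsComplete) (h : A.IndepZ2Realizable) :
    ∃ (t : V → V → ZMod 2) (y : Sym2 V → V → ZMod 2), (∀ u v, u ≠ v → t u v + t v u = 1) ∧
      ∀ a b c d, [a, b, c, d].Nodup →
        A.pairVal a b c d = flipSum t a b c d + switchSum y a b c d := by
  obtain ⟨D, hD⟩ := h
  obtain ⟨t, y, ht, hy⟩ := D.exists_ncard_crossings_eq
  refine ⟨t, y, ht, fun a b c d hd => ?_⟩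
  obtain ⟨hab, hcd, hind⟩ := mk_mem_indepPairs_iff.1 (mem_indepPairs_top_iff.2 hd)
  rw [← show A.graph = ⊤ from hA] at hab hcd
  rw [← isIndepZ2Realization_iff.1 hD a b c d hab hcd hind]
  exact hy ⟨_, hab⟩ ⟨_, hcd⟩ a b c d rfl rfl hind

theorem IsComplete.sumK5_eq_one (hA : A.IsComplete) (h : A.IndepZ2Realizable) {a b c d e : V}
    (hd : [a, b, c, d, e].Nodup) : sumK5 A.pairVal a b c d e = 1 := by
  obtain ⟨t, y, ht, hX⟩ := hA.exists_pairVal_eq h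
  rw [sumK5_congr hX hd, sumK5_add, sumK5_switchSum, add_zero, sumK5_flipSum ht hd]

theorem IsComplete.sum2K3_eq_zero (hA : A.IsComplete) (h : A.IndepZ2Realizable) {a b c d e f : V}
    (hd : [a, b, c, d, e, f].Nodup) : sum2K3 A.pairVal a b c d e f = 0 := by
  obtain ⟨t, y, -, hX⟩ := hA.exists_pairVal_eq h
  rw [sum2K3_congr hX hd, sum2K3_add, sum2K3_switchSum, add_zero, sum2K3_flipSum]

end ATGraph

end Parity

/-! ### The space of edge-vertex switches -/

section SwitchSpace

variable {V : Type*} {G : SimpleGraph V}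

theorem exists_mem_pair_eq_iff {e : Sym2 V} {v a b c d : V} :
    (∃ f : Sym2 V, v ∈ f ∧ s(s(a, b), s(c, d)) = s(e, f)) ↔
      e = s(a, b) ∧ (v = c ∨ v = d) ∨ e = s(c, d) ∧ (v = a ∨ v = b) := by
  simp only [Sym2.eq_iff (x := s(a, b)), ← Sym2.mem_iff]
  constructor
  · rintro ⟨f, hf, ⟨rfl, rfl⟩ | ⟨rfl, rfl⟩⟩
    exacts [.inl ⟨rfl, hf⟩, .inr ⟨rfl, hf⟩]
  · rintro (⟨rfl, h⟩ | ⟨rfl, h⟩)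
    exacts [⟨_, h, .inl ⟨rfl, rfl⟩⟩, ⟨_, h, .inr ⟨rfl, rfl⟩⟩]

theorem switchVector_mem_switchSpace (G : SimpleGraph V) (e : Sym2 V) (v : V) :
    switchVector G e v ∈ switchSpace G := by
  by_cases h : e ∈ G.edgeSet ∧ v ∉ e
  · exact Submodule.subset_span ⟨e, h.1, v, h.2, rfl⟩
  · convert Submodule.zero_mem _
    ext ⟨p, hp⟩
    refine if_neg ?_
    rintro ⟨f, hv, rfl⟩
    obtain ⟨he, -, hind⟩ := mk_mem_indepPairs_iff.1 hp
    exact h ⟨he, fun hve => hind v ⟨hve, hv⟩⟩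

section DecidableEq

variable [DecidableEq V]

theorem switchVector_apply (e : Sym2 V) (v : V) {a b c d : V}
    (h : s(s(a, b), s(c, d)) ∈ indepPairs G) :
    switchVector G e v ⟨_, h⟩ = switchSum (Pi.single e (Pi.single v 1)) a b c d := by
  obtain ⟨hab, hcd, hac, had, -⟩ := mem_indepPairs_iff.1 h
  have hne : s(a, b) ≠ s(c, d) := fun h => by
    rcases Sym2.eq_iff.1 h with ⟨h, -⟩ | ⟨h, -⟩
    exacts [hac h, had h]
  have hab := hab.ne
  have hcd := hcd.ne
  simp only [switchVector, exists_mem_pair_eq_iff, switchSum, Pi.single_apply, ite_apply,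
    Pi.zero_apply]
  grind

theorem switchSum_eq_sum [Fintype V] (Y : Sym2 V → V → ZMod 2) (a b c d : V) :
    switchSum Y a b c d =
      ∑ e, ∑ v, Y e v * switchSum (Pi.single e (Pi.single v 1)) a b c d := by
  simp [switchSum, Pi.single_apply, ite_apply, mul_add, Finset.sum_add_distrib]

end DecidableEq

theorem mem_switchSpace_iff [Finite V] {x : indepPairs G → ZMod 2} :
    x ∈ switchSpace G ↔ ∃ Y : Sym2 V → V → ZMod 2,
      ∀ (a b c d : V) (h : s(s(a, b), s(c, d)) ∈ indepPairs G),
        x ⟨_, h⟩ = switchSum Y a b c d := by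
  classical
  have := Fintype.ofFinite V
  constructor
  · intro hx
    induction hx using Submodule.span_induction with
    | mem w hw =>
      obtain ⟨e, -, v, -, rfl⟩ := hw
      exact ⟨_, fun a b c d => switchVector_apply e v⟩
    | zero => exact ⟨0, fun a b c d _ => by simp [switchSum]⟩
    | add x y _ _ hx hy =>
      obtain ⟨Y, hY⟩ := hx
      obtain ⟨Z, hZ⟩ := hy
      exact ⟨Y + Z, fun a b c d h => by rw [switchSum_add, Pi.add_apply, hY, hZ]⟩
    | smul r x _ hx =>
      obtain ⟨Y, hY⟩ := hx
      exact ⟨r • Y, fun a b c d h => by simp [hY, switchSum, mul_add]⟩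
  · rintro ⟨Y, hY⟩
    have hx : x = ∑ e, ∑ v, Y e v • switchVector G e v := by
      ext ⟨p, hp⟩
      induction p with | _ e f =>
      induction e with | _ a b =>
      induction f with | _ c d =>
      simp only [hY, switchSum_eq_sum Y, Finset.sum_apply, Pi.smul_apply, switchVector_apply,
        smul_eq_mul]
    rw [hx]
    exact Submodule.sum_mem _ fun e _ => Submodule.sum_mem _ fun v _ =>
      Submodule.smul_mem _ _ (switchVector_mem_switchSpace G e v)

theorem pairVal_ofVector (x : indepPairs G → ZMod 2) {a b c d : V}
    (h : s(s(a, b), s(c, d)) ∈ indepPairs G) :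
    (ATGraph.ofVector x).pairVal a b c d = x ⟨_, h⟩ := by
  have hz (z : ZMod 2) : (if z = 1 then 1 else 0) = z := by decide +revert
  classical
  refine (if_congr ⟨fun ⟨_, h'⟩ => h', fun h' => ⟨h, h'⟩⟩ rfl rfl).trans (hz _)

theorem switchSpace_eq_propertyVectors (V : Type*) [Finite V] :
    (switchSpace (⊤ : SimpleGraph V) : Set (indepPairs (⊤ : SimpleGraph V) → ZMod 2)) =
      propertyVectors (⊤ : SimpleGraph V) := by
  ext x
  have hx : (ATGraph.ofVector x).IsComplete := rfl
  change x ∈ switchSpace _ ↔ ¬ _ ∧ ¬ _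
  rw [mem_switchSpace_iff, hx.not_containsOdd_K5_iff, hx.not_containsOdd_2K3_iff]
  constructor
  · rintro ⟨Y, hY⟩
    have hval (a b c d : V) (hd : [a, b, c, d].Nodup) :
        (ATGraph.ofVector x).pairVal a b c d = switchSum Y a b c d := by
      rw [pairVal_ofVector x (mem_indepPairs_top_iff.2 hd), hY]
    exact ⟨fun a b c d e hd => (sumK5_congr hval hd).trans (sumK5_switchSum Y a b c d e),
      fun a b c d e f hd => (sum2K3_congr hval hd).trans (sum2K3_switchSum Y a b c d e f)⟩
  · rintro ⟨hK5, h2K3⟩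
    obtain ⟨Y, hY⟩ := exists_switchSum_eq (ATGraph.isPairSymm_pairVal _) hK5 h2K3
    exact ⟨Y, fun a b c d h => by
      rw [← pairVal_ofVector x h, hY a b c d (mem_indepPairs_top_iff.1 h)]⟩

end SwitchSpace

/-! ### Polynomial arcs -/

section PolynomialArcs

open Complex Polynomial Set Topology

theorem isProperCrossing_of_hasStrictFDerivAt {a b : Set ℂ} {z : ℂ} {f g : ℂ → ℝ}
    {f' g' : ℂ →L[ℝ] ℝ} (hf : HasStrictFDerivAt f f' z) (hg : HasStrictFDerivAt g g' z)
    (hfz : f z = 0) (hgz : g z = 0) (hinj : ∀ w, f' w = 0 → g' w = 0 → w = 0)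
    (ha : ∀ᶠ w in 𝓝 z, w ∈ a ↔ f w = 0) (hb : ∀ᶠ w in 𝓝 z, w ∈ b ↔ g w = 0) :
    IsProperCrossing a b z := by
  let Φ' : ℂ →L[ℝ] ℂ := equivRealProdCLM.symm.toContinuousLinearMap.comp (g'.prod f')
  have hΦ'inj : Function.Injective (Φ' : ℂ →ₗ[ℝ] ℂ) := by
    refine (injective_iff_map_eq_zero _).2 fun w hw => hinj w ?_ ?_
    · simpa [Φ'] using congrArg im hw
    · simpa [Φ'] using congrArg re hw
  let L : ℂ ≃L[ℝ] ℂ := (LinearEquiv.ofInjectiveEndo _ hΦ'inj).toContinuousLinearEquiv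
  have hΦ : HasStrictFDerivAt (fun w => equivRealProdCLM.symm (g w, f w)) (L : ℂ →L[ℝ] ℂ) z :=
    equivRealProdCLM.symm.hasStrictFDerivAt.comp z (hg.prodMk hf)
  obtain ⟨U, hU, hUo, hzU⟩ := eventually_nhds_iff.1 (ha.and hb)
  refine ⟨(hΦ.toOpenPartialHomeomorph _).restrOpen U hUo,
    ⟨hΦ.mem_toOpenPartialHomeomorph_source, hzU⟩, ?_, fun w hw => ?_⟩
  · simp [hfz, hgz]
  · simpa using hU w hw.2

/-- The curve `x = P h`, `y = h + q x`, parametrized by its height `h` over the graph of `q`. -/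
noncomputable def polyCurve (q P : ℝ[X]) (h : ℝ) : ℂ := ⟨P.eval h, h + q.eval (P.eval h)⟩

/-- The height of a point over the graph of `q`. -/
noncomputable def polyHeight (q : ℝ[X]) (z : ℂ) : ℝ := z.im - q.eval z.re

/-- The signed horizontal distance of a point from the point of `polyCurve q P` at its height. -/
noncomputable def polyDefect (q P : ℝ[X]) (z : ℂ) : ℝ := z.re - P.eval (polyHeight q z)

/-- The part of `polyCurve q P` between the heights `0` and `1`. -/
def polyArc (q P : ℝ[X]) : Set ℂ := polyCurve q P '' Icc 0 1

variable {q P : ℝ[X]} {z : ℂ}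

@[simp]
theorem polyHeight_polyCurve (q P : ℝ[X]) (h : ℝ) : polyHeight q (polyCurve q P h) = h := by
  simp [polyHeight, polyCurve]

theorem polyDefect_polyCurve (q P : ℝ[X]) (h : ℝ) : polyDefect q P (polyCurve q P h) = 0 := by
  rw [polyDefect, polyHeight_polyCurve]
  exact sub_self _

theorem polyCurve_polyHeight (hz : polyDefect q P z = 0) :
    polyCurve q P (polyHeight q z) = z := by
  have hre : P.eval (polyHeight q z) = z.re := (sub_eq_zero.1 hz).symm
  refine Complex.ext hre ?_
  rw [polyCurve, hre]
  simp [polyHeight]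

theorem mem_polyArc_iff :
    z ∈ polyArc q P ↔ polyHeight q z ∈ Icc 0 1 ∧ polyDefect q P z = 0 := by
  constructor
  · rintro ⟨h, hh, rfl⟩
    exact ⟨by rwa [polyHeight_polyCurve], polyDefect_polyCurve q P h⟩
  · exact fun ⟨hh, hz⟩ => ⟨_, hh, polyCurve_polyHeight hz⟩

theorem polyHeight_mem_Ioo (hz : z ∈ polyArc q P) (h0 : z ≠ polyCurve q P 0)
    (h1 : z ≠ polyCurve q P 1) : polyHeight q z ∈ Ioo 0 1 := by
  obtain ⟨h, hh, rfl⟩ := hz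
  rw [polyHeight_polyCurve]
  exact ⟨lt_of_le_of_ne hh.1 fun e => h0 (e ▸ rfl), lt_of_le_of_ne hh.2 fun e => h1 (e ▸ rfl)⟩

theorem hasDerivAt_polyCurve (q P : ℝ[X]) (h : ℝ) : HasDerivAt (polyCurve q P)
    ⟨P.derivative.eval h, 1 + q.derivative.eval (P.eval h) * P.derivative.eval h⟩ h :=
  equivRealProdCLM.symm.hasFDerivAt.comp_hasDerivAt h ((P.hasDerivAt h).prodMk
    ((hasDerivAt_id h).add ((q.hasDerivAt _).comp h (P.hasDerivAt h))))

theorem continuous_polyCurve (q P : ℝ[X]) : Continuous (polyCurve q P) :=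
  continuous_iff_continuousAt.2 fun h => (hasDerivAt_polyCurve q P h).continuousAt

theorem hasStrictFDerivAt_polyHeight (q : ℝ[X]) (z : ℂ) :
    HasStrictFDerivAt (polyHeight q) (imCLM - q.derivative.eval z.re • reCLM) z :=
  imCLM.hasStrictFDerivAt.sub ((q.hasStrictDerivAt _).comp_hasStrictFDerivAt z
    reCLM.hasStrictFDerivAt)

theorem hasStrictFDerivAt_polyDefect (q P : ℝ[X]) (z : ℂ) :
    HasStrictFDerivAt (polyDefect q P) (reCLM - P.derivative.eval (polyHeight q z) •
      (imCLM - q.derivative.eval z.re • reCLM)) z :=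
  reCLM.hasStrictFDerivAt.sub ((P.hasStrictDerivAt _).comp_hasStrictFDerivAt z
    (hasStrictFDerivAt_polyHeight q z))

theorem continuous_polyHeight (q : ℝ[X]) : Continuous (polyHeight q) :=
  continuous_iff_continuousAt.2 fun z => (hasStrictFDerivAt_polyHeight q z).continuousAt

theorem eventually_mem_polyArc_iff (hz : polyHeight q z ∈ Ioo 0 1) :
    ∀ᶠ w in 𝓝 z, w ∈ polyArc q P ↔ polyDefect q P w = 0 := by
  filter_upwards [(continuous_polyHeight q).continuousAt (isOpen_Ioo.mem_nhds hz)] with w hw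
  rw [mem_polyArc_iff, and_iff_right (Ioo_subset_Icc_self hw)]

theorem isProperCrossing_polyArc {q' P' : ℝ[X]} {α : ℝ}
    (hz : z ∈ polyArc q P) (hz' : z ∈ polyArc q' P')
    (hh : polyHeight q z ∈ Ioo 0 1) (hh' : polyHeight q' z ∈ Ioo 0 1)
    (hα : HasDerivAt (fun h => polyDefect q' P' (polyCurve q P h)) α (polyHeight q z))
    (hα0 : α ≠ 0) : IsProperCrossing (polyArc q P) (polyArc q' P') z := by
  have hd := (mem_polyArc_iff.1 hz).2
  have hcurve := polyCurve_polyHeight hd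
  have hre : P.eval (polyHeight q z) = z.re := (sub_eq_zero.1 hd).symm
  have hg := hasStrictFDerivAt_polyDefect q' P' z
  refine isProperCrossing_of_hasStrictFDerivAt (hasStrictFDerivAt_polyDefect q P z) hg hd
    (mem_polyArc_iff.1 hz').2 (fun w hfw hgw => ?_) (eventually_mem_polyArc_iff hh)
    (eventually_mem_polyArc_iff hh')
  set τ : ℂ := ⟨P.derivative.eval (polyHeight q z),
    1 + q.derivative.eval z.re * P.derivative.eval (polyHeight q z)⟩ with hτ
  set g' := reCLM - P'.derivative.eval (polyHeight q' z) •
    (imCLM - q'.derivative.eval z.re • reCLM)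
  -- The tangent vector `τ` of the first arc spans the kernel of the derivative of its defect.
  have hτα : g' τ = α := by
    have hτ' := hasDerivAt_polyCurve q P (polyHeight q z)
    rw [hre, ← hτ] at hτ'
    rw [← hcurve] at hg
    exact (hg.hasFDerivAt.comp_hasDerivAt (polyHeight q z) hτ').unique hα
  obtain ⟨m, rfl⟩ : ∃ m : ℝ, w = m • τ := by
    simp only [_root_.sub_apply, _root_.smul_apply, reCLM_apply,
      imCLM_apply, smul_eq_mul] at hfw
    refine ⟨w.im - q.derivative.eval z.re * w.re, Complex.ext ?_ ?_⟩
    · simp only [smul_re, hτ, smul_eq_mul]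
      linear_combination hfw
    · simp only [smul_im, hτ, smul_eq_mul]
      linear_combination q.derivative.eval z.re * hfw
  rw [map_smul, hτα, smul_eq_mul] at hgw
  rw [(mul_eq_zero.1 hgw).resolve_right hα0, zero_smul]

end PolynomialArcs

section CrossProperly

open Complex Polynomial Set MeasureTheory

theorem IsProperCrossing.symm {a b : Set ℂ} {p : ℂ} (h : IsProperCrossing a b p) :
    IsProperCrossing b a p := by
  obtain ⟨φ, hp, h0, hφ⟩ := h
  let swap : ℂ ≃ₜ ℂ := equivRealProdCLM.toHomeomorph.trans
    ((Homeomorph.prodComm ℝ ℝ).trans equivRealProdCLM.symm.toHomeomorph)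
  have hre (z : ℂ) : (swap z).re = z.im := by simp [swap]
  have him (z : ℂ) : (swap z).im = z.re := by simp [swap]
  refine ⟨φ.transHomeomorph swap, hp, ?_, fun z hz => ?_⟩
  · apply Complex.ext <;> simp [hre, him, h0]
  · simpa [hre, him] using (hφ z hz).symm

/-- Two sets of points have finitely many common points, and those outside `S` are proper
crossings. Here `S` is the set of vertices, where arcs may meet in any way. -/
structure CrossProperly (S a b : Set ℂ) : Prop where
  finite_inter : (a ∩ b).Finite
  isProperCrossing : ∀ z ∈ a ∩ b, z ∉ S → IsProperCrossing a b z

theorem CrossProperly.symm {S a b : Set ℂ} (h : CrossProperly S a b) : CrossProperly S b a :=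
  ⟨inter_comm a b ▸ h.finite_inter, fun z hz hzS => (h.isProperCrossing z hz.symm hzS).symm⟩

/-- The member with parameter `c` of a pencil of curves with common endpoints. -/
noncomputable def pencil (P : ℝ[X]) (c : ℝ) : ℝ[X] := P + C c * (X * (X - 1))

@[simp]
theorem polyCurve_pencil_zero (q P : ℝ[X]) (c : ℝ) :
    polyCurve q (pencil P c) 0 = polyCurve q P 0 := by
  simp [polyCurve, pencil]

@[simp]
theorem polyCurve_pencil_one (q P : ℝ[X]) (c : ℝ) :
    polyCurve q (pencil P c) 1 = polyCurve q P 1 := by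
  simp [polyCurve, pencil]

theorem polyDefect_pencil (q P : ℝ[X]) (c : ℝ) (z : ℂ) : polyDefect q (pencil P c) z =
    polyDefect q P z - c * (polyHeight q z * (polyHeight q z - 1)) := by
  simp only [polyDefect, pencil, eval_add, eval_mul, eval_C, eval_X, eval_sub, eval_one]
  ring

theorem ae_notMem_polyArc_pencil (q P : ℝ[X]) {z : ℂ} (h0 : z ≠ polyCurve q P 0)
    (h1 : z ≠ polyCurve q P 1) : ∀ᵐ c : ℝ, z ∉ polyArc q (pencil P c) := by
  set k := polyHeight q z
  filter_upwards [Measure.ae_ne volume (polyDefect q P z / (k * (k - 1)))] with c hc hz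
  obtain ⟨hk0, hk1⟩ := polyHeight_mem_Ioo hz (by rwa [polyCurve_pencil_zero])
    (by rwa [polyCurve_pencil_one])
  have hd := (mem_polyArc_iff.1 hz).2
  rw [polyDefect_pencil, sub_eq_zero] at hd
  exact hc ((eq_div_iff (mul_ne_zero hk0.ne' (sub_ne_zero.2 hk1.ne))).2 hd.symm)

theorem ae_regular_value {f f' : ℝ → ℝ} {U : Set ℝ} (hf : ∀ x ∈ U, HasDerivAt f (f' x) x) :
    ∀ᵐ c : ℝ, ∀ x ∈ U, f x = c → f' x ≠ 0 := by
  have hcrit : volume (f '' {x | x ∈ U ∧ f' x = 0}) = 0 := by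
    refine addHaar_image_eq_zero_of_det_fderivWithin_eq_zero volume
      (f' := fun x => ContinuousLinearMap.toSpanSingleton ℝ (f' x))
      (fun x hx => (hf x hx.1).hasFDerivAt.hasFDerivWithinAt) fun x hx => ?_
    rw [hx.2]
    simp [ContinuousLinearMap.det]
  filter_upwards [measure_eq_zero_iff_ae_notMem.1 hcrit] with c hc x hx hfx h0
  exact hc ⟨x, ⟨hx, h0⟩, hfx⟩

theorem ae_forall_derivative_sub_C_mul_ne_zero (A B : ℝ[X]) :
    ∀ᵐ c : ℝ, ∀ x, B.eval x ≠ 0 → (A - C c * B).eval x = 0 →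
      (derivative (A - C c * B)).eval x ≠ 0 := by
  have hreg := ae_regular_value (f := fun x => A.eval x / B.eval x) (U := {x | B.eval x ≠ 0})
    fun x hx => (A.hasDerivAt x).div (B.hasDerivAt x) hx
  filter_upwards [hreg] with c hc x hBx h0 h0'
  simp only [eval_sub, eval_mul, eval_C, derivative_sub, derivative_C_mul] at h0 h0'
  refine hc x hBx (by rw [div_eq_iff hBx]; linarith) (div_eq_zero_iff.2 (Or.inl ?_))
  linear_combination B.eval x * h0' - (derivative B).eval x * h0

variable (q Q q' P : ℝ[X])

/-- The polynomial giving the height over the graph of `q'` of the point of `polyCurve q Q`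
at a given parameter. -/
noncomputable def heightAlong : ℝ[X] := X + q.comp Q - q'.comp Q

theorem eval_heightAlong (h : ℝ) :
    (heightAlong q Q q').eval h = polyHeight q' (polyCurve q Q h) := by
  simp [heightAlong, polyHeight, polyCurve]

/-- The polynomial giving the defect with respect to the member with parameter `c` of the pencil
of `P` of the point of `polyCurve q Q` at a given parameter. -/
noncomputable def defectAlong (c : ℝ) : ℝ[X] :=
  Q - P.comp (heightAlong q Q q') - C c * (heightAlong q Q q' * (heightAlong q Q q' - 1))

theorem eval_defectAlong (c h : ℝ) :
    (defectAlong q Q q' P c).eval h = polyDefect q' (pencil P c) (polyCurve q Q h) := by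
  rw [polyDefect_pencil, polyDefect, ← eval_heightAlong]
  simp [defectAlong, polyCurve]

theorem heightAlong_ne_C {κ : ℝ} (hQ : Q = C (P.eval κ)) : heightAlong q Q q' ≠ C κ := by
  subst hQ
  intro h
  have h0 := congrArg (eval 0) h
  have h1 := congrArg (eval 1) h
  simp only [heightAlong, eval_sub, eval_add, eval_X, eval_comp, eval_C] at h0 h1
  linarith

theorem ae_defectAlong : ∀ᵐ c : ℝ, defectAlong q Q q' P c ≠ 0 ∧
    ∀ h, polyHeight q' (polyCurve q Q h) ∈ Ioo 0 1 → (defectAlong q Q q' P c).eval h = 0 →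
      (derivative (defectAlong q Q q' P c)).eval h ≠ 0 := by
  set K := heightAlong q Q q' with hK
  filter_upwards [ae_forall_derivative_sub_C_mul_ne_zero (Q - P.comp K) (K * (K - 1))] with c hc
  refine ⟨fun h0 => ?_, fun h hh => hc h ?_⟩
  · have hB : K * (K - 1) = 0 := Polynomial.funext fun h => by
      by_contra hBh
      rw [eval_zero] at hBh
      have h0' : Q - P.comp K - C c * (K * (K - 1)) = 0 := h0
      exact hc h hBh (by rw [h0', eval_zero]) (by rw [h0', derivative_zero, eval_zero])
    obtain ⟨κ, hκ⟩ : ∃ κ, K = C κ := by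
      rcases mul_eq_zero.1 hB with hK0 | hK1
      · exact ⟨0, by rw [hK0, C_0]⟩
      · exact ⟨1, by rw [C_1, sub_eq_zero.1 hK1]⟩
    refine heightAlong_ne_C q Q q' P ?_ hκ
    rw [defectAlong, ← hK, hB, mul_zero, sub_zero, sub_eq_zero, hκ, comp_C] at h0
    exact h0
  · rw [← eval_heightAlong] at hh
    simpa using mul_ne_zero hh.1.ne' (sub_ne_zero.2 hh.2.ne)

theorem ae_crossProperly_polyArc_pencil {S : Set ℂ} (h0 : polyCurve q Q 0 ∈ S)
    (h1 : polyCurve q Q 1 ∈ S) (h0' : polyCurve q' P 0 ∈ S) (h1' : polyCurve q' P 1 ∈ S) :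
    ∀ᵐ c : ℝ, CrossProperly S (polyArc q Q) (polyArc q' (pencil P c)) := by
  filter_upwards [ae_defectAlong q Q q' P] with c ⟨hne, hder⟩
  refine ⟨((defectAlong q Q q' P c).roots.toFinset.finite_toSet.image (polyCurve q Q)).subset ?_,
    fun z ⟨hz, hz'⟩ hzS => ?_⟩
  · rintro z ⟨⟨h, -, rfl⟩, hz'⟩
    refine mem_image_of_mem _ ?_
    simpa [hne, eval_defectAlong] using (mem_polyArc_iff.1 hz').2
  · have hh := polyHeight_mem_Ioo hz (ne_of_mem_of_not_mem h0 hzS).symm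
      (ne_of_mem_of_not_mem h1 hzS).symm
    have hh' := polyHeight_mem_Ioo hz'
      (by simpa using (ne_of_mem_of_not_mem h0' hzS).symm)
      (by simpa using (ne_of_mem_of_not_mem h1' hzS).symm)
    have hcurve := polyCurve_polyHeight (mem_polyArc_iff.1 hz).2
    refine isProperCrossing_polyArc hz hz' hh hh' ?_
      (hder (polyHeight q z) (by rwa [hcurve]) ?_)
    · simpa only [eval_defectAlong] using (defectAlong q Q q' P c).hasDerivAt (polyHeight q z)
    · rw [eval_defectAlong, hcurve, (mem_polyArc_iff.1 hz').2]

end CrossProperly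

section PolynomialTurns

open Complex Polynomial Set

/-- The path of the vector from `z` to `w` obtained by shearing vertically, at speed `1`, the
vector with the same horizontal coordinate and with the difference of heights as vertical one. -/
noncomputable def shear (q : ℝ[X]) (z w : ℂ) (σ : ℝ) : ℂ :=
  ⟨w.re - z.re, polyHeight q w - polyHeight q z + σ * (q.eval w.re - q.eval z.re)⟩

variable {q : ℝ[X]} {z w : ℂ}

@[simp]
theorem shear_one (q : ℝ[X]) (z w : ℂ) : shear q z w 1 = w - z := by
  apply Complex.ext
  · rfl
  · simp only [shear, polyHeight, sub_im]
    ring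

theorem shear_ne_zero {σ : ℝ} (h : w ≠ z) : shear q z w σ ≠ 0 := by
  intro h0
  have hre : w.re = z.re := sub_eq_zero.1 (congrArg re h0)
  have him : polyHeight q w - polyHeight q z + σ * (q.eval w.re - q.eval z.re) = 0 :=
    congrArg im h0
  rw [polyHeight, polyHeight, hre] at him
  exact h (Complex.ext hre (by linarith))

theorem continuous_uncurry_shear (q : ℝ[X]) (z : ℂ) :
    Continuous fun p : ℂ × ℝ => shear q z p.1 p.2 := by
  have := continuous_polyHeight q
  exact equivRealProdCLM.symm.continuous.comp
    (f := fun p : ℂ × ℝ => (p.1.re - z.re,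
      polyHeight q p.1 - polyHeight q z + p.2 * (q.eval p.1.re - q.eval z.re))) (by fun_prop)

theorem logChange_sub_eq_logChange_shear {γ : ℝ → ℂ} (hγ : Continuous γ)
    (hz : ∀ s ∈ uIcc (0 : ℝ) 1, γ s ≠ z) (q : ℝ[X]) :
    logChange (fun s => γ s - z) 0 1 = logChange (fun s => shear q z (γ s) 0) 0 1 +
      logChange (shear q z (γ 1)) 0 1 - logChange (shear q z (γ 0)) 0 1 := by
  have hcont : Continuous (Function.uncurry fun s σ : ℝ => shear q z (γ s) σ) :=
    (continuous_uncurry_shear q z).comp (f := fun p : ℝ × ℝ => (γ p.1, p.2)) (by fun_prop)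
  have hindex := rectIndex_eq_zero (a := 0) (b := 1) (c := 0) (d := 1) hcont.continuousOn
    fun s hs σ _ => shear_ne_zero (hz s hs)
  simp only [rectIndex, shear_one] at hindex
  linear_combination -hindex

theorem log_neg_of_im_pos (h : 0 < w.im) : log (-w) = log w - Real.pi * I := by
  rw [log, log, norm_neg, arg_neg_eq_arg_sub_pi_of_im_pos h]
  push_cast
  ring

theorem log_neg_of_im_neg (h : w.im < 0) : log (-w) = log w + Real.pi * I := by
  rw [log, log, norm_neg, arg_neg_eq_arg_add_pi_of_im_neg h]
  push_cast
  ring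

theorem logChange_of_neg_mem_slitPlane {F : ℝ → ℂ} {a b : ℝ} (hF : ContinuousOn F (uIcc a b))
    (h : ∀ s ∈ uIcc a b, -F s ∈ slitPlane) (ha : (F a).im < 0) (hb : 0 < (F b).im) :
    logChange F a b = log (F b) - log (F a) - 2 * Real.pi * I := by
  have hne : NonvanishingOn F a b :=
    ⟨hF, fun s hs => neg_ne_zero.1 (slitPlane_ne_zero (h s hs))⟩
  rw [← logChange_neg hne, logChange_eq_log_sub_log (F := fun s => -F s) hF.neg h,
    log_neg_of_im_pos hb, log_neg_of_im_neg ha]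
  ring

theorem exists_logChange_polyCurve (za zb : ℂ) (hz : polyHeight q z ∈ Ioo (0 : ℝ) 1) :
    ∃ R : ℂ, ∀ Q : ℝ[X], polyCurve q Q 0 = za → polyCurve q Q 1 = zb →
      (polyDefect q Q z < 0 → logChange (fun s => polyCurve q Q s - z) 0 1 = R) ∧
      (0 < polyDefect q Q z →
        logChange (fun s => polyCurve q Q s - z) 0 1 = R - 2 * Real.pi * I) := by
  refine ⟨log (shear q z zb 0) - log (shear q z za 0) + logChange (shear q z zb) 0 1 -
    logChange (shear q z za) 0 1, ?_⟩
  rintro Q rfl rfl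
  set k := polyHeight q z with hk
  set F : ℝ → ℂ := fun s => shear q z (polyCurve q Q s) 0 with hF
  have hFre (s : ℝ) : (F s).re = Q.eval s - z.re := rfl
  have hFim (s : ℝ) : (F s).im = s - k := by simp [hF, shear, hk]
  have hFcont : Continuous F := (continuous_uncurry_shear q z).comp
    (f := fun s => (polyCurve q Q s, (0 : ℝ))) (by have := continuous_polyCurve q Q; fun_prop)
  have hsplit (hd : polyDefect q Q z ≠ 0) := logChange_sub_eq_logChange_shear (z := z)
    (continuous_polyCurve q Q) (fun s _ hs => hd (hs ▸ polyDefect_polyCurve q Q s)) q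
  refine ⟨fun hd => ?_, fun hd => ?_⟩
  · rw [hsplit hd.ne, logChange_eq_log_sub_log hFcont.continuousOn]
    intro s _
    rw [mem_slitPlane_iff, hFre, hFim, sub_ne_zero]
    exact or_iff_not_imp_right.2 fun hs => by
      rw [not_not.1 hs]
      exact sub_pos.2 (sub_neg.1 hd)
  · rw [hsplit hd.ne', logChange_of_neg_mem_slitPlane hFcont.continuousOn]
    · ring
    · intro s _
      rw [mem_slitPlane_iff, neg_re, neg_im, hFre, hFim, neg_ne_zero, sub_ne_zero, neg_sub]
      exact or_iff_not_imp_right.2 fun hs => by rwa [not_not.1 hs]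
    · rw [hFim]
      linarith [hz.1]
    · rw [hFim]
      linarith [hz.2]

variable {V : Type*} {vert : V → ℂ} {a b v : V}

theorem isArcParam_polyCurve {P : ℝ[X]} (h0 : polyCurve q P 0 = vert a)
    (h1 : polyCurve q P 1 = vert b) :
    IsArcParam vert (polyArc q P) (polyCurve q P) a b where
  continuous := continuous_polyCurve q P
  injOn := (Function.LeftInverse.injective (polyHeight_polyCurve q P)).injOn
  image := rfl
  zero := h0
  one := h1

theorem exists_sign_hasTurns (a b : V) (hv : polyHeight q (vert v) ∈ Ioo (0 : ℝ) 1)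
    (y : ZMod 2) :
    ∃ σ : ℝ, |σ| = 1 ∧ ∀ Q : ℝ[X], polyCurve q Q 0 = vert a → polyCurve q Q 1 = vert b →
      0 < σ * polyDefect q Q (vert v) → HasTurns vert (polyCurve q Q) a b v y := by
  obtain ⟨R, hR⟩ := exists_logChange_polyCurve (vert a) (vert b) hv
  by_cases hy : HasTurnParity (R - (log (vert b - vert v) - log (vert a - vert v))) y
  · refine ⟨-1, by simp, fun Q h0 h1 hd => ?_⟩
    rw [HasTurns, (hR Q h0 h1).1 (by linarith)]
    exact hy
  · refine ⟨1, abs_one, fun Q h0 h1 hd => ?_⟩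
    rw [one_mul] at hd
    obtain ⟨ε, hε⟩ := (isArcParam_polyCurve h0 h1).exists_hasTurns fun hmem =>
      hd.ne' (mem_polyArc_iff.1 hmem).2
    have hεy : ε + 1 ≠ y := by
      rintro rfl
      have h := hε.add hasTurnParity_two_pi_mul_I
      rw [(hR Q h0 h1).2 hd] at h
      exact hy (by convert h using 1; ring)
    have hparity : ∀ δ η : ZMod 2, δ + 1 ≠ η → δ = η := by decide
    exact hparity ε y hεy ▸ hε

end PolynomialTurns

section EdgePencils

open Complex Polynomial Set

variable {V : Type*} [Finite V] {vert : V → ℂ} {a b : V}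

theorem exists_eval_eq {x : V → ℝ} (hx : Function.Injective x) (y : V → ℝ) :
    ∃ P : ℝ[X], ∀ v, P.eval (x v) = y v := by
  classical
  have := Fintype.ofFinite V
  exact ⟨Lagrange.interpolate Finset.univ x y,
    fun v => Lagrange.eval_interpolate_at_node y hx.injOn (Finset.mem_univ v)⟩

theorem exists_polyHeight_eq (hre : Function.Injective fun v => (vert v).re) (h : V → ℝ) :
    ∃ q : ℝ[X], ∀ v, polyHeight q (vert v) = h v := by
  obtain ⟨q, hq⟩ := exists_eval_eq hre fun v => (vert v).im - h v
  exact ⟨q, fun v => by rw [polyHeight, hq, sub_sub_cancel]⟩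

theorem exists_polyDefect_eq {q : ℝ[X]} (hq : Function.Injective fun v => polyHeight q (vert v))
    (d : V → ℝ) : ∃ P : ℝ[X], ∀ v, polyDefect q P (vert v) = d v := by
  obtain ⟨P, hP⟩ := exists_eval_eq hq fun v => (vert v).re - d v
  exact ⟨P, fun v => by rw [polyDefect, hP, sub_sub_cancel]⟩

theorem exists_injective_mem_Ioo (hab : a ≠ b) : ∃ h : V → ℝ, Function.Injective h ∧
    h a = 0 ∧ h b = 1 ∧ ∀ v, v ≠ a → v ≠ b → h v ∈ Ioo (0 : ℝ) 1 := by
  classical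
  obtain ⟨f, hf⟩ := exists_injective_nat V
  have := (Ioo_infinite (zero_lt_one' ℝ)).to_subtype
  let g : V → Ioo (0 : ℝ) 1 := fun v => Infinite.natEmbedding _ (f v)
  have hg : Function.Injective g := (Infinite.natEmbedding _).injective.comp hf
  refine ⟨fun v => if v = a then 0 else if v = b then 1 else g v, fun u v huv => ?_, if_pos rfl,
    by simp [hab.symm], fun v hva hvb => by simp [hva, hvb]⟩
  have hgu := (g u).2
  have hgv := (g v).2
  have hguv : (g u : ℝ) = g v → u = v := fun h => hg (Subtype.ext h)
  grind

theorem mul_sub_mul_pos {σ c h : ℝ} (hσ : |σ| = 1) (hc : |c| < 1) (hh : h ∈ Ioo (0 : ℝ) 1) :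
    0 < σ * (σ - c * (h * (h - 1))) := by
  have hσσ : σ * σ = 1 := by rw [← abs_mul_abs_self, hσ, one_mul]
  have hlt : |σ * c * (h * (h - 1))| < 1 := by
    have hle : |h * (h - 1)| ≤ 1 := abs_le.2 ⟨by nlinarith [hh.1, hh.2], by nlinarith [hh.1, hh.2]⟩
    rw [abs_mul, abs_mul, hσ, one_mul]
    exact (mul_le_of_le_one_right (abs_nonneg c) hle).trans_lt hc
  linarith [(abs_lt.1 hlt).2]

theorem exists_edge_pencil (hre : Function.Injective fun v => (vert v).re) (hab : a ≠ b)
    (y : V → ZMod 2) :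
    ∃ q P : ℝ[X], polyCurve q P 0 = vert a ∧ polyCurve q P 1 = vert b ∧
      ∀ c ∈ Ioo (-1 : ℝ) 1, ∀ v, v ≠ a → v ≠ b → vert v ∉ polyArc q (pencil P c) ∧
        HasTurns vert (polyCurve q (pencil P c)) a b v (y v) := by
  classical
  obtain ⟨h, hinj, ha, hb, hh⟩ := exists_injective_mem_Ioo hab
  obtain ⟨q, hq⟩ := exists_polyHeight_eq hre h
  have hside (v : V) (hva : v ≠ a) (hvb : v ≠ b) :=
    exists_sign_hasTurns a b (hq v ▸ hh v hva hvb) (y v)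
  choose! σ hσ hturns using hside
  obtain ⟨P, hP⟩ := exists_polyDefect_eq (vert := vert) (q := q) (by simpa only [hq] using hinj)
    fun v => if v = a ∨ v = b then 0 else σ v
  have h0 : polyCurve q P 0 = vert a := by
    rw [← ha, ← hq, polyCurve_polyHeight (by rw [hP, if_pos (Or.inl rfl)])]
  have h1 : polyCurve q P 1 = vert b := by
    rw [← hb, ← hq, polyCurve_polyHeight (by rw [hP, if_pos (Or.inr rfl)])]
  refine ⟨q, P, h0, h1, fun c hc v hva hvb => ?_⟩
  have hpos : 0 < σ v * polyDefect q (pencil P c) (vert v) := by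
    rw [polyDefect_pencil, hP, hq, if_neg (not_or.2 ⟨hva, hvb⟩)]
    exact mul_sub_mul_pos (hσ v hva hvb) (abs_lt.2 hc) (hh v hva hvb)
  exact ⟨fun hmem => hpos.ne' (by rw [(mem_polyArc_iff.1 hmem).2, mul_zero]),
    hturns v hva hvb _ (by rw [polyCurve_pencil_zero, h0]) (by rw [polyCurve_pencil_one, h1]) hpos⟩

end EdgePencils

/-! ### Arcs in general position -/

section GeneralPosition

open Complex Set Filter

/-- The arcs `A i` pairwise cross properly, and outside `S` no three of them meet. -/
structure InGeneralPosition {ι : Type*} (S : Set ℂ) (A : ι → Set ℂ) (s : Set ι) : Prop where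
  crossProperly : s.Pairwise fun i j => CrossProperly S (A i) (A j)
  mem_of_mem_of_mem : ∀ i ∈ s, ∀ j ∈ s, ∀ k ∈ s, i ≠ j → i ≠ k → j ≠ k →
    ∀ z, z ∈ A i → z ∈ A j → z ∈ A k → z ∈ S

variable {ι T : Type*} {S : Set ℂ} {l : Filter T} [l.NeBot] {A : ι → T → Set ℂ}

theorem InGeneralPosition.congr {A B : ι → Set ℂ} {s : Set ι} (h : InGeneralPosition S A s)
    (hAB : ∀ i ∈ s, A i = B i) : InGeneralPosition S B s where
  crossProperly i hi j hj hij := by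
    change CrossProperly S (B i) (B j)
    rw [← hAB i hi, ← hAB j hj]
    exact h.crossProperly hi hj hij
  mem_of_mem_of_mem i hi j hj k hk :=
    hAB i hi ▸ hAB j hj ▸ hAB k hk ▸ h.mem_of_mem_of_mem i hi j hj k hk

theorem InGeneralPosition.insert {A : ι → Set ℂ} {s : Set ι} {i : ι} (h : InGeneralPosition S A s)
    (hcross : ∀ j ∈ s, CrossProperly S (A j) (A i))
    (hpoint : ∀ j ∈ s, ∀ k ∈ s, j ≠ k → ∀ z ∈ A j ∩ A k, z ∉ S → z ∉ A i) :
    InGeneralPosition S A (insert i s) where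
  crossProperly := h.crossProperly.insert fun j hj _ => ⟨(hcross j hj).symm, hcross j hj⟩
  mem_of_mem_of_mem := by
    have htriple := h.mem_of_mem_of_mem
    have hpair (j) (hj : j ∈ s) (k) (hk : k ∈ s) (hjk : j ≠ k) (z) (hzj : z ∈ A j)
        (hzk : z ∈ A k) (hzi : z ∈ A i) : z ∈ S := by
      by_contra hzS
      exact hpoint j hj k hk hjk z ⟨hzj, hzk⟩ hzS hzi
    clear h hcross hpoint
    rintro i₁ (rfl | h₁) i₂ (rfl | h₂) i₃ (rfl | h₃) h₁₂ h₁₃ h₂₃ z hz₁ hz₂ hz₃ <;> grind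

theorem exists_inGeneralPosition [Finite ι] {U : Set T} (hU : U ∈ l)
    (hcross : ∀ i j s, ∀ᶠ t in l, CrossProperly S (A i s) (A j t))
    (hpoint : ∀ i, ∀ z ∉ S, ∀ᶠ t in l, z ∉ A i t) :
    ∃ c : ι → T, (∀ i, c i ∈ U) ∧ InGeneralPosition S (fun i => A i (c i)) univ := by
  classical
  have := Fintype.ofFinite ι
  suffices ∀ s : Finset ι, ∃ c : ι → T, (∀ i, c i ∈ U) ∧
      InGeneralPosition S (fun i => A i (c i)) s by
    simpa using this Finset.univ
  intro s
  induction s using Finset.induction_on with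
  | empty =>
    obtain ⟨t, ht⟩ := l.nonempty_of_mem hU
    exact ⟨fun _ => t, fun _ => ht, by constructor <;> simp⟩
  | insert i s hi ih =>
    obtain ⟨c, hcU, hc⟩ := ih
    have hcross' : ∀ᶠ t in l, ∀ j ∈ s, CrossProperly S (A j (c j)) (A i t) :=
      (eventually_all_finset s).2 fun j _ => hcross j i (c j)
    have hpoint' : ∀ᶠ t in l, ∀ j ∈ s, ∀ k ∈ s, j ≠ k →
        ∀ z ∈ A j (c j) ∩ A k (c k), z ∉ S → z ∉ A i t := by
      simp only [eventually_all_finset, eventually_imp_distrib_left]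
      exact fun j hj k hk hjk => ((hc.crossProperly hj hk hjk).finite_inter.eventually_all).2
        fun z _ => eventually_imp_distrib_left.2 (hpoint i z)
    obtain ⟨t, ⟨htU, ht⟩, ht'⟩ := (((eventually_mem_set.2 hU).and hcross').and hpoint').exists
    have hi' : A i (Function.update c i t i) = A i t := by rw [Function.update_self]
    have hs' : ∀ j ∈ s, A j (c j) = A j (Function.update c i t j) := fun j hj => by
      rw [Function.update_of_ne (ne_of_mem_of_not_mem hj hi)]
    refine ⟨Function.update c i t, (Function.forall_update_iff c fun _ x => x ∈ U).2
      ⟨htU, fun j _ => hcU j⟩, ?_⟩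
    rw [Finset.coe_insert]
    refine (hc.congr hs').insert (fun j hj => ?_) fun j hj k hk hjk => ?_
    · rw [hi', ← hs' j hj]
      exact ht j hj
    · rw [hi', ← hs' j hj, ← hs' k hk]
      exact ht' j hj k hk hjk

end GeneralPosition

section DrawingsByArcs

open Complex Polynomial Set MeasureTheory

variable {V : Type*} {G : SimpleGraph V} {vert : V → ℂ} {A : G.edgeSet → Set ℂ}
  {f : G.edgeSet → ℝ → ℂ} {src tgt : G.edgeSet → V}

/-- The drawing of `G` whose edges are given parametrized arcs in general position. -/
def Drawing.ofArcs (hvert : Function.Injective vert)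
    (hends : ∀ e : G.edgeSet, (e : Sym2 V) = s(src e, tgt e))
    (hparam : ∀ e, IsArcParam vert (A e) (f e) (src e) (tgt e))
    (hmem : ∀ (e : G.edgeSet) (v : V), v ∉ (e : Sym2 V) → vert v ∉ A e)
    (hA : InGeneralPosition (range vert) A univ) : Drawing G where
  vert := vert
  vert_injective := hvert
  edge := A
  edge_arc e := by
    refine ⟨⟨fun s => f e s, (hparam e).continuous.comp continuous_subtype_val⟩,
      fun s t hst => Subtype.ext ((hparam e).injOn s.2 t.2 hst), ?_, ?_⟩
    · simp [← (hparam e).image, image_eq_range]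
    · simp [hends e, ← (hparam e).zero, ← (hparam e).one]
  vert_mem_edge v e hv := by_contra fun h => hmem e v h hv
  inter_finite e e' hee' := (hA.crossProperly trivial trivial hee').finite_inter
  inter_proper e e' hee' p hp := by
    by_cases hpv : p ∈ range vert
    · obtain ⟨v, rfl⟩ := hpv
      exact Or.inl ⟨v, by_contra fun h => hmem e v h hp.1, by_contra fun h => hmem e' v h hp.2, rfl⟩
    · exact Or.inr ((hA.crossProperly trivial trivial hee').isProperCrossing p hp hpv)
  no_triple e e' e'' h h' h'' p := hA.mem_of_mem_of_mem e trivial e' trivial e'' trivial h h' h'' p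

theorem exists_edge_pencils [Finite V] (G : SimpleGraph V)
    (hre : Function.Injective fun v => (vert v).re) (y : Sym2 V → V → ZMod 2) :
    ∃ (src tgt : G.edgeSet → V) (q P : G.edgeSet → ℝ[X]),
      (∀ e : G.edgeSet, (e : Sym2 V) = s(src e, tgt e)) ∧
      (∀ e, polyCurve (q e) (P e) 0 = vert (src e)) ∧
      (∀ e, polyCurve (q e) (P e) 1 = vert (tgt e)) ∧
      ∀ e : G.edgeSet, ∀ c ∈ Ioo (-1 : ℝ) 1, ∀ v ∉ (e : Sym2 V),
        vert v ∉ polyArc (q e) (pencil (P e) c) ∧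
        HasTurns vert (polyCurve (q e) (pencil (P e) c)) (src e) (tgt e) v (y e v) := by
  have hedge (e : G.edgeSet) : ∃ (a b : V) (q P : ℝ[X]), (e : Sym2 V) = s(a, b) ∧
      polyCurve q P 0 = vert a ∧ polyCurve q P 1 = vert b ∧
      ∀ c ∈ Ioo (-1 : ℝ) 1, ∀ v ∉ (e : Sym2 V), vert v ∉ polyArc q (pencil P c) ∧
        HasTurns vert (polyCurve q (pencil P c)) a b v (y e v) := by
    obtain ⟨⟨a, b⟩, he⟩ := e
    obtain ⟨q, P, h0, h1, h⟩ := exists_edge_pencil hre (G.ne_of_adj he) (y s(a, b))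
    exact ⟨a, b, q, P, rfl, h0, h1, fun c hc v hv =>
      h c hc v (fun hva => hv (hva ▸ Sym2.mem_mk_left a b))
        (fun hvb => hv (hvb ▸ Sym2.mem_mk_right a b))⟩
  choose src tgt q P hends h0 h1 h using hedge
  exact ⟨src, tgt, q, P, hends, h0, h1, h⟩

theorem exists_drawing_hasCrossingParities [Finite V] (G : SimpleGraph V)
    (hre : Function.Injective fun v => (vert v).re) {t : V → V → ZMod 2} (ht : IsFlip vert t)
    (y : Sym2 V → V → ZMod 2) : ∃ D : Drawing G,
      D.HasCrossingParities fun a b c d => flipSum t a b c d + switchSum y a b c d := by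
  obtain ⟨src, tgt, q, P, hends, h0, h1, hturns⟩ := exists_edge_pencils G hre y
  have hsrc (e : G.edgeSet) : polyCurve (q e) (P e) 0 ∈ range vert := ⟨src e, (h0 e).symm⟩
  have htgt (e : G.edgeSet) : polyCurve (q e) (P e) 1 ∈ range vert := ⟨tgt e, (h1 e).symm⟩
  have : (ae (volume.restrict (Ioo (-1 : ℝ) 1))).NeBot :=
    ae_restrict_neBot.2 (by simp)
  obtain ⟨c, hc, hA⟩ := exists_inGeneralPosition (S := range vert)
    (A := fun e s => polyArc (q e) (pencil (P e) s)) (l := ae (volume.restrict (Ioo (-1 : ℝ) 1)))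
    (ae_restrict_mem measurableSet_Ioo)
    (fun e e' s => ae_restrict_of_ae (ae_crossProperly_polyArc_pencil _ _ _ _ (by simp [hsrc])
      (by simp [htgt]) (hsrc e') (htgt e')))
    (fun e z hz => ae_restrict_of_ae (ae_notMem_polyArc_pencil _ _
      (ne_of_mem_of_not_mem (hsrc e) hz).symm (ne_of_mem_of_not_mem (htgt e) hz).symm))
  have hparam (e : G.edgeSet) := isArcParam_polyCurve (vert := vert) (a := src e) (b := tgt e)
    (q := q e) (P := pencil (P e) (c e)) (by rw [polyCurve_pencil_zero, h0])
    (by rw [polyCurve_pencil_one, h1])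
  let D := Drawing.ofArcs hre.of_comp hends hparam (fun e v hv => (hturns e (c e) (hc e) v hv).1) hA
  exact ⟨D, fun _ _ _ _ _ _ hind => D.ncard_crossings_eq_of_hasTurns ht hends hparam
    (fun e v hv => (hturns e (c e) (hc e) v hv).2) rfl rfl hind⟩

theorem exists_drawing_of_switches [Finite V] (G : SimpleGraph V) :
    ∃ t : V → V → ZMod 2, (∀ u v, u ≠ v → t u v + t v u = 1) ∧
      ∀ y : Sym2 V → V → ZMod 2, ∃ D : Drawing G,
        D.HasCrossingParities fun a b c d => flipSum t a b c d + switchSum y a b c d := by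
  obtain ⟨rank, hrank⟩ := exists_injective_nat V
  let vert : V → ℂ := fun v => (rank v : ℝ)
  have hre : Function.Injective fun v => (vert v).re :=
    Nat.cast_injective.comp hrank
  obtain ⟨t, ht⟩ := exists_isFlip hre.of_comp
  exact ⟨t, fun u v huv => ht.add_eq_one huv, exists_drawing_hasCrossingParities G hre ht⟩

end DrawingsByArcs

section Realizability

variable {V : Type*} {A : ATGraph V}

namespace ATGraph

theorem IsComplete.indepZ2Realizable_iff [Finite V] (hA : A.IsComplete) :
    A.IndepZ2Realizable ↔
      (∀ a b c d e, [a, b, c, d, e].Nodup → sumK5 A.pairVal a b c d e = 1) ∧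
      ∀ a b c d e f, [a, b, c, d, e, f].Nodup → sum2K3 A.pairVal a b c d e f = 0 := by
  refine ⟨fun h => ⟨fun _ _ _ _ _ => hA.sumK5_eq_one h, fun _ _ _ _ _ _ => hA.sum2K3_eq_zero h⟩,
    fun ⟨hK5, h2K3⟩ => ?_⟩
  obtain ⟨t, ht, hdraw⟩ := exists_drawing_of_switches A.graph
  obtain ⟨y, hy⟩ := exists_switchSum_eq (A.isPairSymm_pairVal.add (isPairSymm_flipSum ht))
    (fun a b c d e hd => by
      rw [sumK5_add, hK5 a b c d e hd, sumK5_flipSum ht hd, CharTwo.add_self_eq_zero])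
    (fun a b c d e f hd => by rw [sum2K3_add, h2K3 a b c d e f hd, sum2K3_flipSum, add_zero])
  obtain ⟨D, hD⟩ := hdraw y
  refine ⟨D, isIndepZ2Realization_iff.2 fun a b c d hab hcd hind => ?_⟩
  have hd : [a, b, c, d].Nodup :=
    mem_indepPairs_top_iff.1 (mk_mem_indepPairs_iff.2 ⟨hab.ne, hcd.ne, hind⟩)
  refine (hD a b c d hab hcd hind).trans ?_
  beta_reduce
  rw [← hy a b c d hd, add_left_comm, CharTwo.add_self_eq_zero, add_zero]

theorem IsComplete.sumK5_eq_one_of_sub_induce (hA : A.IsComplete) {s : Set V}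
    (h : (A.sub ((⊤ : A.graph.Subgraph).induce s)).IndepZ2Realizable) {a b c d e : s}
    (hd : [a, b, c, d, e].Nodup) : sumK5 A.pairVal (a : V) b c d e = 1 := by
  have hval : sumK5 (A.sub ((⊤ : A.graph.Subgraph).induce s)).pairVal a b c d e =
      sumK5 (fun p q r s : s => A.pairVal p q r s) a b c d e :=
    sumK5_congr (fun _ _ _ _ => hA.pairVal_sub_induce) hd
  exact hval.symm.trans ((hA.sub_induce s).sumK5_eq_one h hd)

theorem IsComplete.sum2K3_eq_zero_of_sub_induce (hA : A.IsComplete) {s : Set V}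
    (h : (A.sub ((⊤ : A.graph.Subgraph).induce s)).IndepZ2Realizable) {a b c d e f : s}
    (hd : [a, b, c, d, e, f].Nodup) : sum2K3 A.pairVal (a : V) b c d e f = 0 := by
  have hval : sum2K3 (A.sub ((⊤ : A.graph.Subgraph).induce s)).pairVal a b c d e f =
      sum2K3 (fun p q r s : s => A.pairVal p q r s) a b c d e f :=
    sum2K3_congr (fun _ _ _ _ => hA.pairVal_sub_induce) hd
  exact hval.symm.trans ((hA.sub_induce s).sum2K3_eq_zero h hd)

theorem IsComplete.exists_not_indepZ2Realizable_sub [Finite V] (hA : A.IsComplete)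
    (h : ¬ A.IndepZ2Realizable) :
    ∃ H : A.graph.Subgraph, H.verts.ncard ≤ 6 ∧ ¬ (A.sub H).IndepZ2Realizable := by
  classical
  contrapose! h
  have hsub (l : List V) (hl : l.length ≤ 6) :
      (A.sub ((⊤ : A.graph.Subgraph).induce {v | v ∈ l})).IndepZ2Realizable := by
    refine h _ ?_
    rw [SimpleGraph.Subgraph.induce_verts, ← List.coe_toFinset, Set.ncard_coe_finset]
    exact l.toFinset_card_le.trans hl
  refine hA.indepZ2Realizable_iff.2 ⟨fun a b c d e hd => ?_, fun a b c d e f hd => ?_⟩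
  · exact hA.sumK5_eq_one_of_sub_induce (hsub [a, b, c, d, e] (by simp)) (a := ⟨a, by simp⟩)
      (b := ⟨b, by simp⟩) (c := ⟨c, by simp⟩) (d := ⟨d, by simp⟩) (e := ⟨e, by simp⟩)
      (List.Nodup.of_map Subtype.val hd)
  · exact hA.sum2K3_eq_zero_of_sub_induce (hsub [a, b, c, d, e, f] (by simp)) (a := ⟨a, by simp⟩)
      (b := ⟨b, by simp⟩) (c := ⟨c, by simp⟩) (d := ⟨d, by simp⟩) (e := ⟨e, by simp⟩)
      (f := ⟨f, by simp⟩) (List.Nodup.of_map Subtype.val hd)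

end ATGraph

end Realizability

theorem theorem3 {V : Type*} [Finite V] :
    (∀ A : ATGraph V, A.IsComplete →
      (A.IndepZ2Realizable ↔ ¬ A.ContainsEven graphK5 ∧ ¬ A.ContainsOdd graph2K3)) ∧
    (∀ A : ATGraph V, A.IsComplete → ¬ A.IndepZ2Realizable →
      ∃ H : A.graph.Subgraph, H.verts.ncard ≤ 6 ∧ ¬ (A.sub H).IndepZ2Realizable) ∧
    (switchSpace (⊤ : SimpleGraph V) : Set (indepPairs (⊤ : SimpleGraph V) → ZMod 2)) =
      propertyVectors (⊤ : SimpleGraph V) := by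
  refine ⟨fun A hA => ?_, fun A hA => hA.exists_not_indepZ2Realizable_sub,
    switchSpace_eq_propertyVectors V⟩
  rw [hA.not_containsEven_K5_iff, hA.not_containsOdd_2K3_iff]
  exact hA.indepZ2Realizable_iff
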